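/- Let $\mathfrak g$ be a finite-dimensional simple Lie algebra over $\mathbb C$ with a Cartan subalgebra $\mathfrak h$ and triangular decomposition $\mathfrak g=\mathfrak n_-\oplus\mathfrak h\oplus\mathfrak n_+$ given by a choice of positive roots. Let $\tilde{\mathfrak g}=(\mathfrak g\otimes\mathbb C[t^{\pm1}])\oplus\mathbb CK\oplus\mathbb Cd$ be the untwisted affine Kac–Moody algebra, with $K$ central and $$[x\otimes t^m,y\otimes t^n]=[x,y]\otimes t^{m+n}+(x|y)\,m\,\delta_{m+n,0}K,\qquad [d,x\otimes t^m]=m\,x\otimes t^m,$$ where $(\cdot|\cdot)$ is the Killing form of $\mathfrak g$, and let $\hat{\mathfrak g}=(\mathfrak g\otimes\mathbb C[t^{\pm1}])\oplus\mathbb CK\subset\tilde{\mathfrak g}$. Let $a_1,\dots,a_m$ be pairwise distinct nonzero complex numbers and let $\lambda=(\lambda_1,\dots,\lambda_m)\in(\mathfrak h^*)^m$ with $\lambda\neq0$. For each $i$ let $V(\lambda_i)$ be the irreducible highest weight $\mathfrak g$-module with highest weight $\lambda_i$, and let $E(\lambda,a)=V(\lambda_1)\otimes\cdots\otimes V(\lambda_m)$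 be the $\hat{\mathfrak g}$-module on which $K$ acts by $0$ and $$(x\otimes t^k)(v_1\otimes\cdots\otimes v_m)=\sum_{i=1}^m a_i^k\,v_1\otimes\cdots\otimes xv_i\otimes\cdots\otimes v_m\qquad(x\in\mathfrak g,\ k\in\mathbb Z).$$ Let $L$ be an irreducible $\hat{\mathfrak g}$-module such that for every $v\in L$ one has $(\mathfrak g\otimes t^k\mathbb C[t])v=0$ for all sufficiently large $k\in\mathbb N$. Then the induced module $$(E(\lambda,a)\otimes L)[d]=\mathrm{Ind}_{\hat{\mathfrak g}}^{\tilde{\mathfrak g}}(E(\lambda,a)\otimes L)=U(\tilde{\mathfrak g})\otimes_{U(\hat{\mathfrak g})}(E(\lambda,a)\otimes L)$$ is an irreducible $\tilde{\mathfrak g}$-module. -/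

import Mathlib

open scoped TensorProduct LaurentPolynomial

noncomputable section

attribute [local instance] LieRing.ofAssociativeRing

namespace AffineLie

/-! ### The loop algebra, the affine algebra and its derived algebra -/

section Affine

variable (g : Type*) [LieRing g] [LieAlgebra ℂ g]

/-- The loop algebra `ℂ[t, t⁻¹] ⊗ g`, with bracket `[p ⊗ x, q ⊗ y] = p q ⊗ [x, y]`. -/
def Loop : Type _ := LieAlgebra.loopAlgebra ℂ ℤ g

namespace Loop

instance : LieRing (Loop g) := inferInstanceAs (LieRing (LieAlgebra.loopAlgebra ℂ ℤ g))

instance : LieAlgebra ℂ (Loop g) := inferInstanceAs (LieAlgebra ℂ (LieAlgebra.loopAlgebra ℂ ℤ g))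

/-- The identification of the loop algebra with `ℂ[t, t⁻¹] ⊗ g`. -/
def equiv : Loop g ≃ₗ[ℂ] ℂ[T;T⁻¹] ⊗[ℂ] g := LinearEquiv.refl ℂ (LieAlgebra.loopAlgebra ℂ ℤ g)

variable {g}

/-- The element `x ⊗ p` of the loop algebra, for a Laurent polynomial `p`. -/
def tmul (p : ℂ[T;T⁻¹]) (x : g) : Loop g := (equiv g).symm (p ⊗ₜ[ℂ] x)

/-- The element `x ⊗ t ^ n` of the loop algebra. -/
def monomial (n : ℤ) (x : g) : Loop g := tmul (LaurentPolynomial.T n) x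

lemma equiv_monomial (n : ℤ) (x : g) :
    equiv g (monomial n x) = LaurentPolynomial.T n ⊗ₜ[ℂ] x := rfl

/-- The loop algebra is spanned by the elements `x ⊗ t ^ n`. -/
lemma induction {P : Loop g → Prop} (zero : P 0) (monomial : ∀ (n : ℤ) (x : g), P (monomial n x))
    (add : ∀ a b, P a → P b → P (a + b)) (a : Loop g) : P a := by
  have hs (f : ℤ →₀ g) : P ((equiv g).symm ((LieAlgebra.LoopAlgebra.toFinsupp ℂ ℤ g).symm f)) := by
    induction f using Finsupp.induction_linear with
    | zero => simpa using zero
    | add f f' hf hf' => rw [map_add, map_add]; exact add _ _ hf hf'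
    | single n x => rw [LieAlgebra.LoopAlgebra.toFinsupp_symm_single]; exact monomial n x
  simpa using hs (LieAlgebra.LoopAlgebra.toFinsupp ℂ ℤ g (equiv g a))

lemma monomial_lie (m n : ℤ) (x y : g) :
    ⁅monomial m x, monomial n y⁆ = monomial (m + n) ⁅x, y⁆ := by
  have h : ⁅monomial m x, monomial n y⁆ =
      tmul (LaurentPolynomial.T m * LaurentPolynomial.T n) ⁅x, y⁆ := rfl
  rw [h, monomial, LaurentPolynomial.T_add]

lemma smul_monomial (r : ℂ) (n : ℤ) (x : g) : r • monomial n x = monomial n (r • x) :=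
  (TensorProduct.tmul_smul r (LaurentPolynomial.T n : ℂ[T;T⁻¹]) x).symm

end Loop

/-- The degree operator `t d/dt` on Laurent polynomials, `t ^ n ↦ n t ^ n`. -/
def laurentDegree : ℂ[T;T⁻¹] →ₗ[ℂ] ℂ[T;T⁻¹] :=
  (AddMonoidAlgebra.basis ℤ ℂ).constr ℂ fun n : ℤ => (n : ℂ) • (LaurentPolynomial.T n : ℂ[T;T⁻¹])

/-- The degree operator `d` on the loop algebra, `x ⊗ t ^ n ↦ n x ⊗ t ^ n`. -/
def loopDegree : Loop g →ₗ[ℂ] Loop g :=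
  (Loop.equiv g).symm.toLinearMap ∘ₗ laurentDegree.rTensor g ∘ₗ (Loop.equiv g).toLinearMap

/-- The bilinear form on the loop algebra with
`(x ⊗ t ^ m, y ⊗ t ^ n) ↦ m δ_{m+n,0} (x|y)`, where `(x|y)` is the Killing form. -/
def loopCocycle : LinearMap.BilinForm ℂ (Loop g) :=
  (LieAlgebra.LoopAlgebra.residuePairing ℂ ℤ g (killingForm ℂ g)).flip.compl₁₂
    (Loop.equiv g).toLinearMap (Loop.equiv g).toLinearMap

variable {g}

lemma laurentDegree_T (n : ℤ) :
    laurentDegree (LaurentPolynomial.T n) = (n : ℂ) • (LaurentPolynomial.T n : ℂ[T;T⁻¹]) := by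
  have h := (AddMonoidAlgebra.basis ℤ ℂ).constr_basis ℂ
    (fun n : ℤ => (n : ℂ) • (LaurentPolynomial.T n : ℂ[T;T⁻¹])) n
  rw [AddMonoidAlgebra.basis_apply] at h
  exact h

lemma loopDegree_monomial (n : ℤ) (x : g) :
    loopDegree g (Loop.monomial n x) = (n : ℂ) • Loop.monomial n x := by
  have h : loopDegree g (Loop.monomial n x) =
      (Loop.equiv g).symm (laurentDegree (LaurentPolynomial.T n) ⊗ₜ[ℂ] x) := rfl
  rw [h, laurentDegree_T, ← TensorProduct.smul_tmul', map_smul]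
  rfl

lemma loopCocycle_monomial (m n : ℤ) (x y : g) :
    loopCocycle g (Loop.monomial m x) (Loop.monomial n y) =
      if m + n = 0 then (m : ℂ) * killingForm ℂ g x y else 0 := by
  have h (k : ℤ) (z : g) : LieAlgebra.LoopAlgebra.toFinsupp ℂ ℤ g (Loop.equiv g (Loop.monomial k z))
      = Finsupp.single k z := LieAlgebra.LoopAlgebra.toFinsupp_single_tmul ℂ ℤ g k z
  have h' : loopCocycle g (Loop.monomial m x) (Loop.monomial n y) =
      LieAlgebra.LoopAlgebra.residuePairing ℂ ℤ g (killingForm ℂ g)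
        (Loop.equiv g (Loop.monomial n y)) (Loop.equiv g (Loop.monomial m x)) := rfl
  rw [h', LieAlgebra.LoopAlgebra.residuePairing_apply_apply, h, h,
    Finsupp.sum_single_index (by simp)]
  by_cases hmn : m + n = 0
  · have hn : n = -m := by lia
    subst hn
    simp [LieModule.traceForm_comm ℂ g g x y]
  · rw [Finsupp.single_eq_of_ne (by lia)]
    simp [hmn]

lemma loopDegree_lie (a b : Loop g) :
    loopDegree g ⁅a, b⁆ = ⁅loopDegree g a, b⁆ + ⁅a, loopDegree g b⁆ := by
  induction a using Loop.induction with
  | zero => simp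
  | add a a' ha ha' => simp only [add_lie, map_add, ha, ha']; abel
  | monomial m x =>
    induction b using Loop.induction with
    | zero => simp
    | add b b' hb hb' => simp only [lie_add, map_add, hb, hb']; abel
    | monomial n y =>
      simp only [Loop.monomial_lie, loopDegree_monomial, smul_lie, lie_smul, ← add_smul]
      push_cast; rfl

lemma loopCocycle_self (a : Loop g) : loopCocycle g a a = 0 := by
  have h (a b : Loop g) : loopCocycle g a b + loopCocycle g b a = 0 := by
    induction a using Loop.induction with
    | zero => simp
    | add a a' ha ha' =>
      simp only [map_add, LinearMap.add_apply]
      linear_combination ha + ha'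
    | monomial m x =>
      induction b using Loop.induction with
      | zero => simp
      | add b b' hb hb' =>
        simp only [map_add, LinearMap.add_apply]
        linear_combination hb + hb'
      | monomial n y =>
        simp only [loopCocycle_monomial, LieModule.traceForm_comm ℂ g g y x]
        by_cases hmn : m + n = 0
        · have hn : n = -m := by lia
          subst hn
          simp
        · simp [hmn, add_comm n m]
  have := h a a
  grind

lemma loopCocycle_loopDegree (a b : Loop g) :
    loopCocycle g (loopDegree g a) b + loopCocycle g a (loopDegree g b) = 0 := by
  induction a using Loop.induction with
  | zero => simp
  | add a a' ha ha' =>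
    simp only [map_add, LinearMap.add_apply]
    linear_combination ha + ha'
  | monomial m x =>
    induction b using Loop.induction with
    | zero => simp
    | add b b' hb hb' =>
      simp only [map_add]
      linear_combination hb + hb'
    | monomial n y =>
      simp only [loopDegree_monomial, map_smul, LinearMap.smul_apply, loopCocycle_monomial]
      by_cases hmn : m + n = 0
      · have hn : n = -m := by lia
        subst hn
        simp
      · simp [hmn]

lemma loopCocycle_lie (a b c : Loop g) :
    loopCocycle g a ⁅b, c⁆ = loopCocycle g ⁅a, b⁆ c + loopCocycle g b ⁅a, c⁆ := by
  induction a using Loop.induction with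
  | zero => simp
  | add a a' ha ha' =>
    simp only [map_add, LinearMap.add_apply, add_lie]
    linear_combination ha + ha'
  | monomial m x =>
    induction b using Loop.induction with
    | zero => simp
    | add b b' hb hb' =>
      simp only [map_add, LinearMap.add_apply, add_lie, lie_add]
      linear_combination hb + hb'
    | monomial n y =>
      induction c using Loop.induction with
      | zero => simp
      | add c c' hc hc' =>
        simp only [map_add, lie_add]
        linear_combination hc + hc'
      | monomial k z =>
        simp only [Loop.monomial_lie, loopCocycle_monomial]
        have h1 : killingForm ℂ g ⁅x, y⁆ z = killingForm ℂ g x ⁅y, z⁆ :=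
          LieModule.traceForm_apply_lie_apply ℂ g g x y z
        have h2 : killingForm ℂ g y ⁅x, z⁆ = - killingForm ℂ g x ⁅y, z⁆ := by
          rw [← h1, ← lie_skew x y, map_neg, LinearMap.neg_apply, neg_neg]
          exact (LieModule.traceForm_apply_lie_apply ℂ g g y x z).symm
        by_cases hmn : m + n + k = 0
        · have hk : k = -m - n := by lia
          subst hk
          rw [if_pos (by lia), if_pos (by lia), if_pos (by lia), h1, h2]
          push_cast; ring
        · rw [if_neg (by lia), if_neg (by lia), if_neg (by lia)]
          simp

variable (g)

/-- The untwisted affine Kac-Moody algebra `(g ⊗ ℂ[t, t⁻¹]) ⊕ ℂ K ⊕ ℂ d`: the element with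
components `loop = a`, `central = c`, `degree = e` is `a + c K + e d`. -/
@[ext]
structure Affine where
  loop : Loop g
  central : ℂ
  degree : ℂ

namespace Affine

/-- The components of an element of the affine algebra. -/
def equivProd : Affine g ≃ Loop g × ℂ × ℂ where
  toFun x := (x.loop, x.central, x.degree)
  invFun x := ⟨x.1, x.2.1, x.2.2⟩

instance : AddCommGroup (Affine g) := (equivProd g).addCommGroup

instance : Module ℂ (Affine g) := (equivProd g).module ℂ

variable {g}

@[simp] lemma loop_zero : (0 : Affine g).loop = 0 := rfl
@[simp] lemma central_zero : (0 : Affine g).central = 0 := rfl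
@[simp] lemma degree_zero : (0 : Affine g).degree = 0 := rfl
@[simp] lemma loop_add (x y : Affine g) : (x + y).loop = x.loop + y.loop := rfl
@[simp] lemma central_add (x y : Affine g) : (x + y).central = x.central + y.central := rfl
@[simp] lemma degree_add (x y : Affine g) : (x + y).degree = x.degree + y.degree := rfl
@[simp] lemma loop_smul (r : ℂ) (x : Affine g) : (r • x).loop = r • x.loop := rfl
@[simp] lemma central_smul (r : ℂ) (x : Affine g) : (r • x).central = r * x.central := rfl
@[simp] lemma degree_smul (r : ℂ) (x : Affine g) : (r • x).degree = r * x.degree := rfl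

/-- The bracket of the affine algebra: `K` is central, `d` acts on the loop algebra by the degree
operator, and `[x ⊗ t ^ m, y ⊗ t ^ n] = [x, y] ⊗ t ^ (m + n) + (x|y) m δ_{m+n,0} K`. -/
instance : Bracket (Affine g) (Affine g) where
  bracket x y :=
    { loop := ⁅x.loop, y.loop⁆ + x.degree • loopDegree g y.loop - y.degree • loopDegree g x.loop
      central := loopCocycle g x.loop y.loop
      degree := 0 }

@[simp] lemma loop_lie (x y : Affine g) : ⁅x, y⁆.loop =
    ⁅x.loop, y.loop⁆ + x.degree • loopDegree g y.loop - y.degree • loopDegree g x.loop := rfl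
@[simp] lemma central_lie (x y : Affine g) : ⁅x, y⁆.central = loopCocycle g x.loop y.loop := rfl
@[simp] lemma degree_lie (x y : Affine g) : ⁅x, y⁆.degree = 0 := rfl

lemma jacobi_loop (a b c : Loop g) (r s t : ℂ) :
    ⁅a, ⁅b, c⁆ + s • loopDegree g c - t • loopDegree g b⁆ +
        r • loopDegree g (⁅b, c⁆ + s • loopDegree g c - t • loopDegree g b) =
      ⁅⁅a, b⁆ + r • loopDegree g b - s • loopDegree g a, c⁆ -
          t • loopDegree g (⁅a, b⁆ + r • loopDegree g b - s • loopDegree g a) +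
        (⁅b, ⁅a, c⁆ + r • loopDegree g c - t • loopDegree g a⁆ +
          s • loopDegree g (⁅a, c⁆ + r • loopDegree g c - t • loopDegree g a)) := by
  have h1 : ⁅b, loopDegree g a⁆ = -⁅loopDegree g a, b⁆ := (lie_skew _ _).symm
  simp only [map_add, map_sub, map_smul, loopDegree_lie, lie_add, lie_sub, lie_smul, add_lie,
    sub_lie, smul_lie, leibniz_lie a b c, h1]
  module

lemma jacobi_central (a b c : Loop g) (r s t : ℂ) :
    loopCocycle g a (⁅b, c⁆ + s • loopDegree g c - t • loopDegree g b) =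
      loopCocycle g (⁅a, b⁆ + r • loopDegree g b - s • loopDegree g a) c +
        loopCocycle g b (⁅a, c⁆ + r • loopDegree g c - t • loopDegree g a) := by
  simp only [map_add, map_sub, map_smul, LinearMap.add_apply, LinearMap.sub_apply,
    LinearMap.smul_apply, smul_eq_mul]
  have h1 := loopCocycle_lie a b c
  have h2 := loopCocycle_loopDegree b c
  have h3 := loopCocycle_loopDegree a c
  have h4 := loopCocycle_loopDegree a b
  have h5 : loopCocycle g b (loopDegree g a) + loopCocycle g (loopDegree g a) b = 0 := by
    have e1 := loopCocycle_self (b + loopDegree g a)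
    simp only [map_add, LinearMap.add_apply, loopCocycle_self] at e1
    linear_combination e1
  linear_combination h1 - r * h2 + s * h3 - t * h4 + t * h5

instance : LieRing (Affine g) where
  add_lie x y z := by
    ext1
    · simp only [loop_lie, loop_add, degree_add, add_lie, map_add, add_smul, smul_add]; abel
    · simp
    · simp
  lie_add x y z := by
    ext1
    · simp only [loop_lie, loop_add, degree_add, lie_add, map_add, add_smul, smul_add]; abel
    · simp
    · simp
  lie_self x := by
    ext1
    · simp
    · simp [loopCocycle_self]
    · simp
  leibniz_lie x y z := by
    ext1
    · simpa only [loop_lie, loop_add, degree_lie, zero_smul, sub_zero, zero_add, add_zero] using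
        jacobi_loop x.loop y.loop z.loop x.degree y.degree z.degree
    · exact jacobi_central x.loop y.loop z.loop x.degree y.degree z.degree
    · simp

instance : LieAlgebra ℂ (Affine g) where
  lie_smul r x y := by
    ext1
    · simp only [loop_lie, loop_smul, degree_smul, lie_smul, map_smul, smul_sub, smul_add,
        mul_smul]
      rw [smul_comm x.degree r]
    · simp
    · simp

variable (g)

/-- The subalgebra `(g ⊗ ℂ[t, t⁻¹]) ⊕ ℂ K` of the affine algebra. -/
def derived : LieSubalgebra ℂ (Affine g) where
  carrier := {x | x.degree = 0}
  zero_mem' := rfl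
  add_mem' {x y} hx hy := by
    have hx : x.degree = 0 := hx
    have hy : y.degree = 0 := hy
    simp [hx, hy]
  smul_mem' r x hx := by
    have hx : x.degree = 0 := hx
    simp [hx]
  lie_mem' _ _ := rfl

variable {g}

/-- A loop, seen as an element of `(g ⊗ ℂ[t, t⁻¹]) ⊕ ℂ K`. -/
def ofLoop (a : Loop g) : derived g := ⟨⟨a, 0, 0⟩, rfl⟩

variable (g)

/-- The projection of `(g ⊗ ℂ[t, t⁻¹]) ⊕ ℂ K` onto the loop algebra, with kernel `ℂ K`. -/
def toLoop : derived g →ₗ⁅ℂ⁆ Loop g where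
  toFun x := x.1.loop
  map_add' _ _ := rfl
  map_smul' _ _ := rfl
  map_lie' {x y} := by
    have hx : x.1.degree = 0 := x.2
    have hy : y.1.degree = 0 := y.2
    simp [hx, hy]

end Affine

end Affine

/-! ### Highest weight modules over `g` -/

section HighestWeight

variable {g : Type*} [LieRing g] [LieAlgebra ℂ g] [FiniteDimensional ℂ g]
  [LieAlgebra.IsSimple ℂ g] {H : LieSubalgebra ℂ g} [H.IsCartanSubalgebra]
  (b : (LieAlgebra.IsKilling.rootSystem H).Base) (wt : Module.Dual ℂ H)
  {V : Type*} [AddCommGroup V] [Module ℂ V] [LieRingModule g V]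

/-- A highest weight vector of weight `wt` for the Cartan subalgebra `H` and the positive roots
determined by the base `b`: a nonzero vector on which `H` acts through `wt` and which is killed by
every positive root space, that is, by `n₊`. -/
structure IsHighestWeightVector (v : V) : Prop where
  ne_zero : v ≠ 0
  cartan (h : H) : ⁅(h : g), v⁆ = wt h • v
  pos (α : H.root) (hα : b.IsPos α) (x : g) (hx : x ∈ LieAlgebra.rootSpace H α.1) : ⁅x, v⁆ = 0

variable (V)

/-- A highest weight module of highest weight `wt`: one generated by a highest weight vector. -/
def IsHighestWeightModule [LieModule ℂ g V] : Prop :=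
  ∃ v : V, IsHighestWeightVector b wt v ∧ LieSubmodule.lieSpan ℂ g {v} = ⊤

end HighestWeight

/-! ### Evaluation modules -/

section Evaluation

/-- Evaluation of Laurent polynomials at a nonzero point, `t ^ n ↦ a ^ n`. -/
def evalLaurent (a : ℂˣ) : ℂ[T;T⁻¹] →ₗ[ℂ] ℂ :=
  (AddMonoidAlgebra.basis ℤ ℂ).constr ℂ fun n : ℤ => ((a ^ n : ℂˣ) : ℂ)

lemma evalLaurent_T (a : ℂˣ) (n : ℤ) :
    evalLaurent a (LaurentPolynomial.T n) = ((a ^ n : ℂˣ) : ℂ) := by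
  have h := (AddMonoidAlgebra.basis ℤ ℂ).constr_basis ℂ
    (fun n : ℤ => ((a ^ n : ℂˣ) : ℂ)) n
  rw [AddMonoidAlgebra.basis_apply] at h
  exact h

variable (g : Type*) [LieRing g] [LieAlgebra ℂ g]

/-- Evaluation of loops at a nonzero point, as a linear map. -/
def evalLoopLinear (a : ℂˣ) : Loop g →ₗ[ℂ] g :=
  (TensorProduct.lid ℂ g).toLinearMap ∘ₗ (evalLaurent a).rTensor g ∘ₗ (Loop.equiv g).toLinearMap

variable {g} in
lemma evalLoopLinear_monomial (a : ℂˣ) (n : ℤ) (x : g) :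
    evalLoopLinear g a (Loop.monomial n x) = ((a ^ n : ℂˣ) : ℂ) • x := by
  simp [evalLoopLinear, Loop.equiv_monomial, evalLaurent_T]

/-- Evaluation of loops at a nonzero point, `x ⊗ t ^ n ↦ a ^ n x`. -/
def evalLoop (a : ℂˣ) : Loop g →ₗ⁅ℂ⁆ g where
  __ := evalLoopLinear g a
  map_lie' {y z} := by
    change evalLoopLinear g a ⁅y, z⁆ = ⁅evalLoopLinear g a y, evalLoopLinear g a z⁆
    induction y using Loop.induction with
    | zero => simp
    | add y y' hy hy' => simp only [add_lie, map_add, hy, hy']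
    | monomial m x =>
      induction z using Loop.induction with
      | zero => simp
      | add z z' hz hz' => simp only [lie_add, map_add, hz, hz']
      | monomial n w =>
        simp only [Loop.monomial_lie, evalLoopLinear_monomial, smul_lie, lie_smul, smul_smul]
        rw [zpow_add, Units.val_mul, mul_comm]

variable {m : ℕ} (V : Fin m → Type*) [∀ i, AddCommGroup (V i)] [∀ i, Module ℂ (V i)]

/-- An operator on the `i`-th factor, acting on the tensor product of all the factors:
`f ↦ 1 ⊗ ⋯ ⊗ f ⊗ ⋯ ⊗ 1`. -/
def slot (i : Fin m) : Module.End ℂ (V i) →ₗ[ℂ] Module.End ℂ (⨂[ℂ] i, V i) :=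
  (PiTensorProduct.mapMultilinear ℂ V V).toLinearMap (fun _ => LinearMap.id) i

variable {V}

lemma slot_apply (i : Fin m) (f : Module.End ℂ (V i)) :
    slot V i f = PiTensorProduct.map (Function.update (fun _ => LinearMap.id) i f) := rfl

lemma slot_mul (i : Fin m) (f f' : Module.End ℂ (V i)) :
    slot V i (f * f') = slot V i f * slot V i f' := by
  rw [slot_apply, slot_apply, slot_apply, ← PiTensorProduct.map_mul]
  congr 1
  funext j
  by_cases hj : j = i
  · subst hj; simp
  · simp only [Function.update_of_ne hj]; rfl

lemma slot_comm {i j : Fin m} (hij : i ≠ j) (f : Module.End ℂ (V i)) (f' : Module.End ℂ (V j)) :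
    slot V i f * slot V j f' = slot V j f' * slot V i f := by
  rw [slot_apply, slot_apply, ← PiTensorProduct.map_mul, ← PiTensorProduct.map_mul]
  congr 1
  funext k
  by_cases hi : k = i
  · subst hi; simp only [Function.update_of_ne hij]; rfl
  · simp only [Function.update_of_ne hi]; rfl

variable (V) [∀ i, LieRingModule g (V i)] [∀ i, LieModule ℂ g (V i)]

/-- The operators of the evaluation module: `x ⊗ t ^ k` acts on `v₁ ⊗ ⋯ ⊗ v_m` as
`∑ i, a_i ^ k v₁ ⊗ ⋯ ⊗ x v_i ⊗ ⋯ ⊗ v_m`. -/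
def evalEnd (a : Fin m → ℂˣ) : Loop g →ₗ⁅ℂ⁆ Module.End ℂ (⨂[ℂ] i, V i) where
  __ := ∑ i, slot V i ∘ₗ (LieModule.toEnd ℂ g (V i)).toLinearMap ∘ₗ (evalLoop g (a i)).toLinearMap
  map_lie' {y z} := by
    let F (i : Fin m) (y : Loop g) := slot V i (LieModule.toEnd ℂ g (V i) (evalLoop g (a i) y))
    suffices h : ∑ i, F i ⁅y, z⁆ = ⁅∑ i, F i y, ∑ i, F i z⁆ by
      simpa [F, LinearMap.sum_apply] using h
    rw [LieRing.of_associative_ring_bracket, Finset.sum_mul_sum, Finset.sum_mul_sum,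
      Finset.sum_comm (f := fun i j => F i z * F j y), ← Finset.sum_sub_distrib]
    refine Finset.sum_congr rfl fun i _ => ?_
    rw [← Finset.sum_sub_distrib, Finset.sum_eq_single i]
    · simp only [F, LieHom.map_lie, LieRing.of_associative_ring_bracket, map_sub, slot_mul]
    · intro j _ hj
      rw [slot_comm hj.symm, sub_self]
    · simp

/-- The space `V₁ ⊗ ⋯ ⊗ V_m` of the evaluation module at the points `a₁, …, a_m`. -/
@[nolint unusedArguments]
def Eval (_a : Fin m → ℂˣ) : Type _ := ⨂[ℂ] i, V i

namespace Eval

variable (a : Fin m → ℂˣ)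

instance : AddCommGroup (Eval V a) := inferInstanceAs (AddCommGroup (⨂[ℂ] i, V i))

instance : Module ℂ (Eval V a) := inferInstanceAs (Module ℂ (⨂[ℂ] i, V i))

/-- The action of `(g ⊗ ℂ[t, t⁻¹]) ⊕ ℂ K` on the evaluation module, with `K` acting by zero. -/
def rho : Affine.derived g →ₗ⁅ℂ⁆ Module.End ℂ (Eval V a) :=
  (evalEnd g V a).comp (Affine.toLoop g)

instance : LieRingModule (Affine.derived g) (Eval V a) :=
  LieRingModule.compLieHom (Eval V a) (rho g V a)

instance : LieModule ℂ (Affine.derived g) (Eval V a) :=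
  LieModule.compLieHom (Eval V a) (rho g V a)

end Eval

end Evaluation

/-! ### Induced modules -/

section Induced

variable {A : Type*} [LieRing A] [LieAlgebra ℂ A] (B : LieSubalgebra ℂ A)
  (M : Type*) [AddCommGroup M] [Module ℂ M] [LieRingModule B M]

/-- The relations `u y ⊗ v = u ⊗ y v`, for `u ∈ U(A)`, `y ∈ B` and `v ∈ M`. As `B` generates
`U(B)`, dividing `U(A) ⊗_ℂ M` by them gives `U(A) ⊗_{U(B)} M`. -/
def indRel : Submodule (UniversalEnvelopingAlgebra ℂ A) (UniversalEnvelopingAlgebra ℂ A ⊗[ℂ] M) :=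
  Submodule.span _ {z | ∃ (u : UniversalEnvelopingAlgebra ℂ A) (y : B) (v : M),
    z = (u * UniversalEnvelopingAlgebra.ι ℂ (y : A)) ⊗ₜ[ℂ] v - u ⊗ₜ[ℂ] ⁅y, v⁆}

/-- The induced module `U(A) ⊗_{U(B)} M` of a module `M` over a Lie subalgebra `B` of `A`. -/
def Ind : Type _ := (UniversalEnvelopingAlgebra ℂ A ⊗[ℂ] M) ⧸ indRel B M

namespace Ind

instance : AddCommGroup (Ind B M) := inferInstanceAs (AddCommGroup (_ ⧸ indRel B M))

instance : Module (UniversalEnvelopingAlgebra ℂ A) (Ind B M) :=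
  inferInstanceAs (Module _ (_ ⧸ indRel B M))

instance : Module ℂ (Ind B M) := inferInstanceAs (Module ℂ (_ ⧸ indRel B M))

instance : IsScalarTower ℂ (UniversalEnvelopingAlgebra ℂ A) (Ind B M) :=
  inferInstanceAs (IsScalarTower ℂ _ (_ ⧸ indRel B M))

/-- An element `x` of `A` acts by left multiplication on the factor `U(A)`. -/
instance : LieRingModule A (Ind B M) where
  bracket x z := UniversalEnvelopingAlgebra.ι ℂ x • z
  add_lie x y z := by
    rw [map_add, add_smul]
  lie_add x z w := smul_add (UniversalEnvelopingAlgebra.ι ℂ x) z w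
  leibniz_lie x y z := by
    rw [LieHom.map_lie, LieRing.of_associative_ring_bracket, sub_smul, mul_smul, mul_smul,
      sub_add_cancel]

lemma lie_def (x : A) (z : Ind B M) : ⁅x, z⁆ = UniversalEnvelopingAlgebra.ι ℂ x • z := rfl

instance : LieModule ℂ A (Ind B M) where
  smul_lie r x z := by rw [lie_def, lie_def, map_smul, smul_assoc]
  lie_smul r x z := by rw [lie_def, lie_def, smul_algebra_smul_comm]

end Ind

end Induced

end AffineLie

end

/-!
Write `E = V₁ ⊗ ⋯ ⊗ V_m`. Every element of the induced module has the form `∑ j ≤ N, d ^ j ⊗ u_j`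
with `u_j ∈ E ⊗ L` (`Affine.degreeExpansion_surjective`), and `(x ⊗ t ^ k) d = (d - k) (x ⊗ t ^ k)`.
For large `k`, the element `x ⊗ t ^ k` kills the components in `L` of all the `u_j`, so that it maps
the above element to `∑ j, ∑ i, a_i ^ k (d - k) ^ j ⊗ x_i u_j`, where `x_i` denotes `x` acting on the
`i`-th factor. The functions `a_i ^ k k ^ l` of `k` are linearly independent
(`coeff_eq_zero_of_expPoly_eq_zero`), hence a submodule `W` containing the given element contains all
the coefficients, in particular `1 ⊗ x_i u_N` (`of_slotEnd_mem`).

Let `W₀` be the space of the `u ∈ E ⊗ L` with `1 ⊗ u ∈ W`. The case `N = 0` shows that `W₀` is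
stable under all the `x_i`, hence also under the action on the factor `L` alone. As the `V_i` have
countable dimension, their endomorphisms are scalars, and the Jacobson density theorem shows that
`E ⊗ L` is irreducible under these operators (`eq_bot_or_eq_top_of_slotEnd_mem`). If `W ≠ 0`, then
`W₀ ≠ 0`: the leading coefficient `u_N` of an element of `W` may be taken nonzero, and for a factor
with `λ_i ≠ 0` some `x_i u_N` is nonzero (`exists_slotEnd_ne_zero`). So `W₀` is everything, and so
is `W`.

It remains to see that the induced module is nonzero. This needs no Poincaré-Birkhoff-Witt theorem:
the affine algebra acts on functions `ℤ → M` (`Affine.twist`), and the constant functions give an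
equivariant embedding of `M` (`Affine.of_injective`).
-/

open scoped TensorProduct LaurentPolynomial

noncomputable section

attribute [local instance] LieRing.ofAssociativeRing LieAlgebra.ofAssociativeAlgebra

namespace AffineLie

/-! ### Operators on spaces of countable dimension, exponential polynomials -/

section LinearAlgebra

open Polynomial in
/-- Dixmier's argument: if `φ - c` is invertible for every `c`, then so is `p(φ)` for every `p ≠ 0`,
and the vectors `(φ - c)⁻¹ v`, `c ∈ ℂ`, are linearly independent: there are uncountably many of
them. -/
theorem spectrum_nonempty_of_rank_le_aleph0 {V : Type*} [AddCommGroup V] [Module ℂ V]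
    [Nontrivial V] (hV : Module.rank ℂ V ≤ Cardinal.aleph0) (φ : Module.End ℂ V) :
    (spectrum ℂ φ).Nonempty := by
  by_contra hempty
  rw [Set.not_nonempty_iff_eq_empty] at hempty
  have hunit (c : ℂ) : IsUnit (φ - algebraMap ℂ _ c) := by
    have h : c ∉ spectrum ℂ φ := by simp [hempty]
    have := (spectrum.notMem_iff.mp h).neg
    rwa [neg_sub] at this
  have hpoly (p : ℂ[X]) (hp : p ≠ 0) : IsUnit (aeval φ p) := by
    rcases le_or_gt p.degree 0 with hd | hd
    · rw [eq_C_of_degree_le_zero hd, aeval_C]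
      refine IsUnit.map (algebraMap ℂ (Module.End ℂ V)) (IsUnit.mk0 _ fun h0 => hp ?_)
      rw [eq_C_of_degree_le_zero hd, h0, C_0]
    · rw [← spectrum.zero_notMem_iff ℂ, spectrum.map_polynomial_aeval_of_degree_pos φ p hd, hempty]
      simp
  obtain ⟨v, hv⟩ := exists_ne (0 : V)
  choose u hu using hunit
  have hli : LinearIndependent ℂ fun c : ℂ => ((u c)⁻¹ : (Module.End ℂ V)ˣ).1 v := by
    rw [linearIndependent_iff']
    intro s m hm i hi
    let q (c : ℂ) : ℂ[X] := ∏ j ∈ s.erase c, (X - C j)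
    have hq (c : ℂ) (hc : c ∈ s) :
        aeval φ (∏ j ∈ s, (X - C j)) (((u c)⁻¹ : (Module.End ℂ V)ˣ).1 v) = aeval φ (q c) v := by
      rw [← Finset.prod_erase_mul s _ hc, map_mul, Module.End.mul_apply, ← Module.End.mul_apply]
      simp only [map_sub, aeval_X, aeval_C, ← hu, Module.End.mul_apply, q]
      rw [← Module.End.mul_apply (u c).1, Units.mul_inv, Module.End.one_apply]
    -- Clear the denominators in the relation `∑ m c • (φ - c)⁻¹ v = 0`.
    have hsum : aeval φ (∑ c ∈ s, C (m c) * q c) v = 0 := by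
      rw [← (aeval φ (∏ j ∈ s, (X - C j))).map_zero, ← hm, map_sum, map_sum,
        LinearMap.sum_apply]
      refine Finset.sum_congr rfl fun c hc => ?_
      rw [map_smul, hq c hc, map_mul, aeval_C, Module.End.mul_apply, Module.algebraMap_end_apply]
    have hp : ∑ c ∈ s, C (m c) * q c = 0 := by
      by_contra hp
      exact hv (((Module.End.isUnit_iff _).mp (hpoly _ hp)).injective (hsum.trans (map_zero _).symm))
    -- At `i`, only the summand of index `i` survives.
    have hi' := congr_arg (eval i) hp
    simp only [eval_finsetSum, eval_mul, eval_C, q, eval_prod, eval_sub, eval_X, eval_zero] at hi'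
    rw [Finset.sum_eq_single_of_mem i hi] at hi'
    · refine (mul_eq_zero.mp hi').resolve_right (Finset.prod_ne_zero_iff.mpr fun j hj => ?_)
      exact sub_ne_zero.mpr (Finset.ne_of_mem_erase hj).symm
    · intro c _ hc
      rw [Finset.prod_eq_zero (i := i) (Finset.mem_erase.mpr ⟨hc.symm, hi⟩) (sub_self i), mul_zero]
  have h1 := hli.cardinal_lift_le_rank
  have h2 := h1.trans (Cardinal.lift_le.mpr hV)
  simp only [Cardinal.mk_complex, Cardinal.lift_continuum, Cardinal.lift_aleph0] at h2
  exact absurd Cardinal.aleph0_lt_continuum h2.not_gt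

/-- The shift operator `F ↦ (k ↦ F (k + 1))` on sequences in `Q`. -/
def shift (Q : Type*) [AddCommGroup Q] [Module ℂ Q] : Module.End ℂ (ℕ → Q) :=
  LinearMap.funLeft ℂ Q Nat.succ

variable {Q : Type*} [AddCommGroup Q] [Module ℂ Q]

lemma mem_maxGenEigenspace_of_sub_mem {M : Type*} [AddCommGroup M] [Module ℂ M]
    (S : Module.End ℂ M) (c : ℂ) (F : M)
    (h : (S - algebraMap ℂ _ c) F ∈ S.maxGenEigenspace c) : F ∈ S.maxGenEigenspace c := by
  rw [Module.End.mem_maxGenEigenspace] at h ⊢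
  obtain ⟨k, hk⟩ := h
  exact ⟨k + 1, by rw [pow_succ]; exact hk⟩

/-- The sequence `c ^ k (k + k₀) ^ l w` is a generalized eigenvector of the shift operator: applying
`shift - c` to it leaves exponential polynomials of lower degree. -/
lemma expPoly_mem_maxGenEigenspace (c : ℂ) (k₀ l : ℕ) (w : Q) :
    (fun k : ℕ => (c ^ k * ((k + k₀ : ℕ) : ℂ) ^ l) • w) ∈ (shift Q).maxGenEigenspace c := by
  induction l using Nat.strong_induction_on generalizing w with
  | _ l ih =>
    apply mem_maxGenEigenspace_of_sub_mem
    have : (shift Q - algebraMap ℂ _ c) (fun k : ℕ => (c ^ k * ((k + k₀ : ℕ) : ℂ) ^ l) • w) =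
        ∑ r ∈ Finset.range l,
          fun k : ℕ => (c ^ k * ((k + k₀ : ℕ) : ℂ) ^ r) • ((c * (l.choose r : ℂ)) • w) := by
      funext k
      simp only [LinearMap.sub_apply, Pi.sub_apply, shift, LinearMap.funLeft_apply,
        Module.algebraMap_end_apply, Pi.smul_apply, Finset.sum_apply, smul_smul, ← sub_smul,
        ← Finset.sum_smul]
      congr 1
      have e : ((Nat.succ k + k₀ : ℕ) : ℂ) = ((k + k₀ : ℕ) : ℂ) + 1 := by push_cast; ring
      rw [e, add_pow, Finset.sum_range_succ]
      simp only [one_pow, mul_one, Nat.choose_self, Nat.cast_one, mul_add, pow_succ, Finset.mul_sum]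
      rw [← mul_assoc, mul_comm c (c ^ k), add_sub_cancel_right]
      exact Finset.sum_congr rfl fun r _ => by ring
    rw [this]
    exact Submodule.sum_mem _ fun r hr => ih r (Finset.mem_range.mp hr) _

/-- The sequences `a ^ k k ^ l`, for `a ≠ 0`, are linearly independent over any vector space, even
when only large `k` are considered: the parts belonging to different `a` are separated by the
generalized eigenspaces of the shift operator. -/
theorem coeff_eq_zero_of_expPoly_eq_zero {ι : Type*} [Fintype ι] (a : ι → ℂˣ)
    (ha : Function.Injective a) (N k₀ : ℕ) (w : ι → ℕ → Q)
    (h : ∀ k, k₀ ≤ k → ∑ i, ∑ l ∈ Finset.range N, ((a i : ℂ) ^ k * (k : ℂ) ^ l) • w i l = 0)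
    (i : ι) (l : ℕ) (hl : l < N) : w i l = 0 := by
  classical
  let F (i : ι) : ℕ → Q := ∑ l ∈ Finset.range N,
    fun k : ℕ => ((a i : ℂ) ^ k * ((k + k₀ : ℕ) : ℂ) ^ l) • ((a i : ℂ) ^ k₀ • w i l)
  have hF (i : ι) : F i ∈ (shift Q).maxGenEigenspace (a i : ℂ) :=
    Submodule.sum_mem _ fun l _ => expPoly_mem_maxGenEigenspace _ _ _ _
  have hind : iSupIndep fun i => (shift Q).maxGenEigenspace (a i : ℂ) :=
    (shift Q).independent_maxGenEigenspace.comp (Units.val_injective.comp ha)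
  have hsum : ∑ i, F i = 0 := by
    funext k
    simp only [F, Finset.sum_apply, smul_smul, Pi.zero_apply]
    rw [← h (k + k₀) (by lia)]
    refine Finset.sum_congr rfl fun i _ => Finset.sum_congr rfl fun l _ => ?_
    congr 1
    rw [pow_add]; ring
  have hF0 : F i = 0 :=
    ((iSupIndep_iff_finsetSum_eq_zero_imp_eq_zero _).mp hind) Finset.univ F (fun j _ => hF j) hsum i
      (Finset.mem_univ i)
  rw [← Module.forall_dual_apply_eq_zero_iff ℂ]
  intro φ
  let p : Polynomial ℂ := ∑ l ∈ Finset.range N, Polynomial.monomial l (φ (w i l))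
  have hp : p = 0 := by
    refine Polynomial.eq_zero_of_infinite_isRoot p (Set.Infinite.mono (s := Set.range
      fun k : ℕ => ((k + k₀ : ℕ) : ℂ)) ?_ (Set.infinite_range_of_injective fun x y hxy => ?_))
    · rintro _ ⟨k, rfl⟩
      have := congr_arg φ (congr_fun hF0 k)
      simp only [F, Finset.sum_apply, smul_smul, Pi.zero_apply, map_sum, map_smul, map_zero,
        smul_eq_mul] at this
      have hne : (a i : ℂ) ^ (k + k₀) ≠ 0 := pow_ne_zero _ (a i).ne_zero
      refine (mul_eq_zero.mp ?_).resolve_left hne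
      simp only [p, Polynomial.eval_finsetSum, Polynomial.eval_monomial, Finset.mul_sum]
      rw [← this]
      exact Finset.sum_congr rfl fun l _ => by rw [pow_add]; ring
    · simpa using hxy
  have := congr_arg (fun p => Polynomial.coeff p l) hp
  simpa [p, Polynomial.finsetSum_coeff, Polynomial.coeff_monomial, hl] using this

end LinearAlgebra

/-! ### Density of the action on an irreducible module -/

section Density

variable {g : Type*} [LieRing g] [LieAlgebra ℂ g] [FiniteDimensional ℂ g]
  {V : Type*} [AddCommGroup V] [Module ℂ V] [LieRingModule g V] [LieModule ℂ g V]

variable (g V) in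
/-- The associative algebra of operators on `V` generated by the action of `g`. -/
def actionAlgebra : Subalgebra ℂ (Module.End ℂ V) :=
  Algebra.adjoin ℂ (Set.range (LieModule.toEnd ℂ g V))

lemma rank_actionAlgebra_le : Module.rank ℂ (actionAlgebra g V) ≤ Cardinal.aleph0 := by
  let b := Module.finBasis ℂ g
  have h : actionAlgebra g V =
      Algebra.adjoin ℂ (Set.range fun i => LieModule.toEnd ℂ g V (b i)) := by
    rw [actionAlgebra, ← Algebra.adjoin_span (R := ℂ) (s := Set.range fun i => LieModule.toEnd ℂ g V (b i))]
    congr 1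
    have : (Set.range fun i => LieModule.toEnd ℂ g V (b i)) =
        (LieModule.toEnd ℂ g V : g →ₗ[ℂ] Module.End ℂ V) '' Set.range b := by
      rw [← Set.range_comp]; rfl
    rw [this, ← Submodule.map_span, b.span_eq, Submodule.map_top]
    rfl
  rw [h]
  refine (Algebra.rank_adjoin_le _).trans (max_le ?_ le_rfl)
  exact (Set.countable_range _).le_aleph0

omit [FiniteDimensional ℂ g] in
lemma isSimpleModule_actionAlgebra (hV : LieModule.IsIrreducible ℂ g V) :
    IsSimpleModule (actionAlgebra g V) V := by
  have hnt : Nontrivial V := (LieSubmodule.nontrivial_iff ℂ g V).mp inferInstance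
  refine { exists_pair_ne := ⟨⊥, ⊤, bot_ne_top⟩, eq_bot_or_eq_top := fun N => ?_ }
  let N' : LieSubmodule ℂ g V :=
    { N.restrictScalars ℂ with
      lie_mem := fun {x v} hv =>
        N.smul_mem (⟨LieModule.toEnd ℂ g V x, Algebra.subset_adjoin ⟨x, rfl⟩⟩ : actionAlgebra g V)
          hv }
  have hN (v : V) : v ∈ N' ↔ v ∈ N := Iff.rfl
  rcases hV.eq_bot_or_eq_top N' with h | h
  · left; ext v; rw [← hN, h]; simp
  · right; ext v; rw [← hN, h]; simp

/-- Density of the action of `g` on an irreducible module `V`: any linear operator agrees on any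
finite set with an element of the associative algebra generated by `g`. As `V` has countable
dimension, its endomorphisms are scalars, so that Jacobson density applies to every operator. -/
theorem exists_mem_actionAlgebra_eqOn (hV : LieModule.IsIrreducible ℂ g V) (f : Module.End ℂ V)
    (s : Finset V) : ∃ r ∈ actionAlgebra g V, ∀ v ∈ s, r v = f v := by
  have := isSimpleModule_actionAlgebra hV
  have hnt : Nontrivial V := (LieSubmodule.nontrivial_iff ℂ g V).mp inferInstance
  obtain ⟨v₀, hv₀⟩ := exists_ne (0 : V)
  have hrank : Module.rank ℂ V ≤ Cardinal.aleph0 := by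
    let e : actionAlgebra g V →ₗ[ℂ] V :=
      (LinearMap.toSpanSingleton (actionAlgebra g V) V v₀).restrictScalars ℂ
    have he : Function.Surjective e := IsSimpleModule.toSpanSingleton_surjective _ hv₀
    have h1 := e.lift_rank_le_of_surjective he
    have h2 := rank_actionAlgebra_le (g := g) (V := V)
    simpa using h1.trans (Cardinal.lift_le.mpr h2)
  have hscalar (φ : Module.End (actionAlgebra g V) V) : ∃ c : ℂ, ∀ v, φ v = c • v := by
    obtain ⟨c, hc⟩ := spectrum_nonempty_of_rank_le_aleph0 hrank (φ.restrictScalars ℂ)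
    refine ⟨c, fun v => ?_⟩
    rcases LinearMap.bijective_or_eq_zero
      (algebraMap ℂ (Module.End (actionAlgebra g V) V) c - φ) with h | h
    · exact absurd ((Module.End.isUnit_iff (algebraMap ℂ (Module.End ℂ V) c -
        φ.restrictScalars ℂ)).mpr h) hc
    · have := LinearMap.congr_fun h v
      exact (sub_eq_zero.mp this).symm
  let f' : Module.End (Module.End (actionAlgebra g V) V) V :=
    { toFun := f
      map_add' := map_add f
      map_smul' := fun φ v => by
        obtain ⟨c, hc⟩ := hscalar φ
        simp [hc] }
  obtain ⟨r, hr⟩ := jacobson_density (R := actionAlgebra g V) f' s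
  exact ⟨r.1, r.2, fun v hv => (hr v hv).symm⟩

end Density

/-! ### Subspaces of `V₁ ⊗ ⋯ ⊗ V_m ⊗ L` stable under every factor -/

section TensorIrreducible

variable {g : Type*} [LieRing g] [LieAlgebra ℂ g] [FiniteDimensional ℂ g]
  {m : ℕ} {V : Fin m → Type*} [∀ i, AddCommGroup (V i)] [∀ i, Module ℂ (V i)]
  {L : Type*} [AddCommGroup L] [Module ℂ L]

variable (V L) in
/-- An operator on the `i`-th factor `V i`, acting on `V₁ ⊗ ⋯ ⊗ V_m ⊗ L`. -/
def slotEnd (i : Fin m) : Module.End ℂ (V i) →ₗ[ℂ] Module.End ℂ ((⨂[ℂ] i, V i) ⊗[ℂ] L) :=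
  LinearMap.rTensorHom L ∘ₗ slot V i

lemma slotEnd_tmul (i : Fin m) (f : Module.End ℂ (V i)) (u : ⨂[ℂ] i, V i) (w : L) :
    slotEnd V L i f (u ⊗ₜ w) = slot V i f u ⊗ₜ w := rfl

lemma slotEnd_mul (i : Fin m) (f f' : Module.End ℂ (V i)) :
    slotEnd V L i (f * f') = slotEnd V L i f * slotEnd V L i f' := by
  simp only [slotEnd, LinearMap.comp_apply, slot_mul, LinearMap.coe_rTensorHom,
    LinearMap.rTensor_mul]

lemma slotEnd_one (i : Fin m) : slotEnd V L i 1 = 1 := by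
  have : slot V i 1 = 1 := by
    rw [slot_apply, ← PiTensorProduct.map_one]
    congr 1
    exact Function.update_eq_self i _
  simp only [slotEnd, LinearMap.comp_apply, this, LinearMap.coe_rTensorHom]
  exact LinearMap.rTensor_id _ _

lemma slotEnd_comm {i j : Fin m} (hij : i ≠ j) (f : Module.End ℂ (V i)) (f' : Module.End ℂ (V j)) :
    slotEnd V L i f * slotEnd V L j f' = slotEnd V L j f' * slotEnd V L i f := by
  simp only [slotEnd, LinearMap.comp_apply, LinearMap.coe_rTensorHom, ← LinearMap.rTensor_mul,
    slot_comm hij]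

lemma lTensor_slotEnd (i : Fin m) (f : Module.End ℂ (V i)) (h : Module.End ℂ L)
    (z : (⨂[ℂ] i, V i) ⊗[ℂ] L) :
    h.lTensor _ (slotEnd V L i f z) = slotEnd V L i f (h.lTensor _ z) := by
  induction z using TensorProduct.induction_on with
  | zero => simp
  | add x y hx hy => simp only [map_add, hx, hy]
  | tmul u w => simp [slotEnd_tmul]

/-- The value of `slotEnd V L i f` at a given tensor depends on finitely many values of `f`. -/
lemma exists_finset_slotEnd_eq (i : Fin m) (z : (⨂[ℂ] i, V i) ⊗[ℂ] L) :
    ∃ s : Finset (V i), ∀ f f' : Module.End ℂ (V i), (∀ v ∈ s, f v = f' v) →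
      slotEnd V L i f z = slotEnd V L i f' z := by
  classical
  induction z using TensorProduct.induction_on with
  | zero => exact ⟨∅, by simp⟩
  | add x y hx hy =>
    obtain ⟨s, hs⟩ := hx
    obtain ⟨t, ht⟩ := hy
    refine ⟨s ∪ t, fun f f' h => ?_⟩
    rw [map_add, map_add, hs f f' fun v hv => h v (Finset.mem_union_left _ hv),
      ht f f' fun v hv => h v (Finset.mem_union_right _ hv)]
  | tmul u w =>
    suffices h : ∃ s : Finset (V i), ∀ f f' : Module.End ℂ (V i), (∀ v ∈ s, f v = f' v) →
        slot V i f u = slot V i f' u by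
      obtain ⟨s, hs⟩ := h
      exact ⟨s, fun f f' h => by rw [slotEnd_tmul, slotEnd_tmul, hs f f' h]⟩
    induction u using PiTensorProduct.induction_on with
    | smul_tprod r v =>
      refine ⟨{v i}, fun f f' h => ?_⟩
      rw [map_smul, map_smul, slot_apply, slot_apply, PiTensorProduct.map_tprod,
        PiTensorProduct.map_tprod]
      congr 2
      funext j
      by_cases hj : j = i
      · subst hj; simpa using h
      · simp [Function.update_of_ne hj]
    | add x y hx hy =>
      obtain ⟨s, hs⟩ := hx
      obtain ⟨t, ht⟩ := hy
      refine ⟨s ∪ t, fun f f' h => ?_⟩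
      rw [map_add, map_add, hs f f' fun v hv => h v (Finset.mem_union_left _ hv),
        ht f f' fun v hv => h v (Finset.mem_union_right _ hv)]

variable [∀ i, LieRingModule g (V i)] [∀ i, LieModule ℂ g (V i)]

lemma slotEnd_mem_of_irreducible (hV : ∀ i, LieModule.IsIrreducible ℂ g (V i))
    {Z : Submodule ℂ ((⨂[ℂ] i, V i) ⊗[ℂ] L)}
    (hZ : ∀ (i : Fin m) (x : g), ∀ z ∈ Z, slotEnd V L i (LieModule.toEnd ℂ g (V i) x) z ∈ Z)
    (i : Fin m) (f : Module.End ℂ (V i)) : ∀ z ∈ Z, slotEnd V L i f z ∈ Z := by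
  intro z hz
  obtain ⟨s, hs⟩ := exists_finset_slotEnd_eq i z
  obtain ⟨r, hr, hrs⟩ := exists_mem_actionAlgebra_eqOn (hV i) f s
  rw [← hs r f hrs]
  clear hrs hs
  induction hr using Algebra.adjoin_induction generalizing z with
  | mem r hr => obtain ⟨x, rfl⟩ := hr; exact hZ i x z hz
  | algebraMap c =>
    rw [Algebra.algebraMap_eq_smul_one, map_smul, slotEnd_one]
    exact Z.smul_mem c hz
  | add p q _ _ hp hq => rw [map_add]; exact Z.add_mem (hp z hz) (hq z hz)
  | mul p q _ _ hp hq => rw [slotEnd_mul]; exact hp _ (hq z hz)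

lemma rTensor_map_mem_of_slotEnd_mem {Z : Submodule ℂ ((⨂[ℂ] i, V i) ⊗[ℂ] L)}
    (hZ : ∀ (i : Fin m) (f : Module.End ℂ (V i)), ∀ z ∈ Z, slotEnd V L i f z ∈ Z)
    (f : ∀ i, Module.End ℂ (V i)) {z : (⨂[ℂ] i, V i) ⊗[ℂ] L} (hz : z ∈ Z) :
    (PiTensorProduct.map f).rTensor L z ∈ Z := by
  classical
  have h (s : Finset (Fin m)) :
      (PiTensorProduct.map fun i => if i ∈ s then f i else 1).rTensor L z ∈ Z := by
    induction s using Finset.induction_on with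
    | empty =>
      have : (PiTensorProduct.map fun i => if i ∈ (∅ : Finset (Fin m)) then f i else 1) = 1 := by
        simp
      rw [this]
      simpa [Module.End.one_eq_id] using hz
    | insert j s hj ih =>
      have : (PiTensorProduct.map fun i => if i ∈ insert j s then f i else 1) =
          slot V j (f j) * PiTensorProduct.map fun i => if i ∈ s then f i else 1 := by
        rw [slot_apply, ← PiTensorProduct.map_mul]
        congr 1
        funext i
        by_cases hi : i = j
        · subst hi; simp [hj]
        · simp only [Function.update_of_ne hi, Finset.mem_insert, hi, false_or]; rfl
      rw [this, LinearMap.rTensor_mul]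
      exact hZ j (f j) _ ih
  simpa using h Finset.univ

/-- For a basis of `V₁ ⊗ ⋯ ⊗ V_m` made of pure tensors, `w` is one of the nonzero coefficients of `z`
in `L`, and `f` is the product of the rank one operators that pick this coefficient. -/
lemma exists_rTensor_map_eq_tprod_tmul {z : (⨂[ℂ] i, V i) ⊗[ℂ] L} (hz : z ≠ 0) :
    ∃ w : L, w ≠ 0 ∧ ∀ v : ∀ i, V i, ∃ f : ∀ i, Module.End ℂ (V i),
      (PiTensorProduct.map f).rTensor L z = PiTensorProduct.tprod ℂ v ⊗ₜ w := by
  let b (i : Fin m) := Module.Free.chooseBasis ℂ (V i)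
  let B := Basis.piTensorProduct b
  let e := TensorProduct.equivFinsuppOfBasisLeft (N := L) B
  obtain ⟨p, hp⟩ := Finsupp.ne_iff.mp (e.map_ne_zero_iff.mpr hz)
  refine ⟨e z p, hp, fun v => ⟨fun i => ((b i).coord (p i)).smulRight (v i), ?_⟩⟩
  clear hp hz
  have hmap : (PiTensorProduct.map fun i => ((b i).coord (p i)).smulRight (v i)) =
      (B.coord p).smulRight (PiTensorProduct.tprod ℂ v) := by
    ext u
    simp only [LinearMap.compMultilinearMap_apply, PiTensorProduct.map_tprod,
      LinearMap.smulRight_apply, Module.Basis.coord_apply, B, Basis.piTensorProduct_repr_tprod_apply]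
    exact (PiTensorProduct.tprod ℂ).map_smul_univ (fun i => (b i).repr (u i) (p i)) v
  rw [hmap]
  induction z using TensorProduct.induction_on with
  | zero => simp
  | add x y hx hy => simp only [map_add, hx, hy, Finsupp.add_apply, TensorProduct.tmul_add]
  | tmul u w =>
    simp only [LinearMap.rTensor_tmul, LinearMap.smulRight_apply, e,
      TensorProduct.equivFinsuppOfBasisLeft_apply_tmul_apply, TensorProduct.smul_tmul,
      Module.Basis.coord_apply]

variable {B : Type*} [LieRing B] [LieAlgebra ℂ B] [LieRingModule B L] [LieModule ℂ B L]

/-- The tensor product of the irreducible modules `V i` and `L` is irreducible for the operators of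
the single factors: by density, a nonzero stable subspace contains `v₁ ⊗ ⋯ ⊗ v_m ⊗ w` for a fixed
`w ≠ 0` and all `v`. -/
theorem eq_bot_or_eq_top_of_slotEnd_mem (hV : ∀ i, LieModule.IsIrreducible ℂ g (V i))
    (hL : LieModule.IsIrreducible ℂ B L) (Z : Submodule ℂ ((⨂[ℂ] i, V i) ⊗[ℂ] L))
    (hZ : ∀ (i : Fin m) (x : g), ∀ z ∈ Z, slotEnd V L i (LieModule.toEnd ℂ g (V i) x) z ∈ Z)
    (hZL : ∀ (y : B), ∀ z ∈ Z, (LieModule.toEnd ℂ B L y).lTensor _ z ∈ Z) :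
    Z = ⊥ ∨ Z = ⊤ := by
  rw [or_iff_not_imp_left]
  intro hne
  obtain ⟨z, hz, hz0⟩ := Z.exists_mem_ne_zero_of_ne_bot hne
  obtain ⟨w, hw, hwf⟩ := exists_rTensor_map_eq_tprod_tmul hz0
  let N : LieSubmodule ℂ B L :=
    { carrier := {l | ∀ v : ∀ i, V i, PiTensorProduct.tprod ℂ v ⊗ₜ l ∈ Z}
      zero_mem' := fun v => by simp
      add_mem' := fun ha hb v => by rw [TensorProduct.tmul_add]; exact Z.add_mem (ha v) (hb v)
      smul_mem' := fun c l hl v => by rw [TensorProduct.tmul_smul]; exact Z.smul_mem c (hl v)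
      lie_mem := fun {y l} hl v => hZL y _ (hl v) }
  have hwN : w ∈ N := fun v => by
    obtain ⟨f, hf⟩ := hwf v
    rw [← hf]
    exact rTensor_map_mem_of_slotEnd_mem (slotEnd_mem_of_irreducible hV hZ) f hz
  have hN : N = ⊤ := (hL.eq_bot_or_eq_top N).resolve_left fun h => hw (by simpa [h] using hwN)
  rw [eq_top_iff]
  rintro z -
  induction z using TensorProduct.induction_on with
  | zero => exact Z.zero_mem
  | add x y hx hy => exact Z.add_mem hx hy
  | tmul u l =>
    induction u using PiTensorProduct.induction_on with
    | smul_tprod r v =>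
      have hl : l ∈ N := by rw [hN]; trivial
      rw [← TensorProduct.smul_tmul']
      exact Z.smul_mem r (hl v)
    | add x y hx hy => rw [TensorProduct.add_tmul]; exact Z.add_mem hx hy

lemma tprod_tmul_ne_zero {v : ∀ i, V i} (hv : ∀ i, v i ≠ 0) {l : L} (hl : l ≠ 0) :
    PiTensorProduct.tprod ℂ v ⊗ₜ[ℂ] l ≠ 0 := by
  choose φ hφ using fun i => Module.Projective.exists_dual_ne_zero ℂ (hv i)
  let Φ : (⨂[ℂ] i, V i) →ₗ[ℂ] ℂ :=
    PiTensorProduct.lift ((MultilinearMap.mkPiAlgebra ℂ (Fin m) ℂ).compLinearMap φ)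
  intro h
  have h' := congr_arg (TensorProduct.lid ℂ L ∘ Φ.rTensor L) h
  simp only [Function.comp_apply, LinearMap.rTensor_tmul, TensorProduct.lid_tmul, map_zero] at h'
  refine smul_ne_zero ?_ hl h'
  simpa [Φ, Finset.prod_ne_zero_iff] using hφ

/-- If `g` acts nontrivially on `V i`, then its action on that factor kills no nonzero tensor: the
tensors killed form a subspace stable under all the factors, which is not the whole space. -/
theorem exists_slotEnd_ne_zero (hV : ∀ i, LieModule.IsIrreducible ℂ g (V i))
    (hL : LieModule.IsIrreducible ℂ B L) (i : Fin m) {v₀ : V i} {h₀ : g} {c : ℂ} (hc : c ≠ 0)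
    (hv₀ : v₀ ≠ 0) (hh : ⁅h₀, v₀⁆ = c • v₀)
    {z : (⨂[ℂ] i, V i) ⊗[ℂ] L} (hz : z ≠ 0) :
    ∃ x : g, slotEnd V L i (LieModule.toEnd ℂ g (V i) x) z ≠ 0 := by
  by_contra! hz'
  let Z : Submodule ℂ ((⨂[ℂ] i, V i) ⊗[ℂ] L) :=
    ⨅ x : g, LinearMap.ker (slotEnd V L i (LieModule.toEnd ℂ g (V i) x))
  have hZ (z) : z ∈ Z ↔ ∀ x : g, slotEnd V L i (LieModule.toEnd ℂ g (V i) x) z = 0 := by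
    simp [Z]
  have hslot (j : Fin m) (y : g) :
      ∀ u ∈ Z, slotEnd V L j (LieModule.toEnd ℂ g (V j) y) u ∈ Z := fun u hu => by
    rw [hZ] at hu ⊢
    intro x
    by_cases hj : j = i
    · subst hj; rw [hu y, map_zero]
    · rw [← Module.End.mul_apply, slotEnd_comm (Ne.symm hj), Module.End.mul_apply, hu x, map_zero]
  have hright (y : B) : ∀ u ∈ Z, (LieModule.toEnd ℂ B L y).lTensor _ u ∈ Z := fun u hu => by
    rw [hZ] at hu ⊢
    intro x
    rw [← lTensor_slotEnd, hu x, map_zero]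
  rcases eq_bot_or_eq_top_of_slotEnd_mem hV hL Z hslot hright with h | h
  · exact hz (by simpa [h] using (hZ z).mpr hz')
  · have hnt (j) : Nontrivial (V j) :=
      (LieSubmodule.nontrivial_iff ℂ g (V j)).mp (hV j).toNontrivial
    have hntL : Nontrivial L := (LieSubmodule.nontrivial_iff ℂ B L).mp hL.toNontrivial
    choose v hv using fun j => exists_ne (0 : V j)
    obtain ⟨l, hl⟩ := exists_ne (0 : L)
    have hne : ∀ j, Function.update v i v₀ j ≠ 0 := fun j => by
      by_cases hj : j = i
      · subst hj; simpa using hv₀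
      · simpa [Function.update_of_ne hj] using hv j
    have h0 := (hZ (PiTensorProduct.tprod ℂ (Function.update v i v₀) ⊗ₜ l)).mp (by rw [h]; trivial) h₀
    have h1 : slot V i (LieModule.toEnd ℂ g (V i) h₀)
        (PiTensorProduct.tprod ℂ (Function.update v i v₀)) =
        c • PiTensorProduct.tprod ℂ (Function.update v i v₀) := by
      rw [slot_apply, PiTensorProduct.map_tprod, ← MultilinearMap.map_update_smul, ← hh]
      congr 1
      funext j
      by_cases hj : j = i
      · subst hj; simp
      · simp [Function.update_of_ne hj]
    rw [slotEnd_tmul, h1, ← TensorProduct.smul_tmul'] at h0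
    exact smul_ne_zero hc (tprod_tmul_ne_zero hne hl) h0

end TensorIrreducible

/-! ### Induced modules -/

section Universal

lemma adjoin_range_ι_eq_top (A : Type*) [LieRing A] [LieAlgebra ℂ A] :
    Algebra.adjoin ℂ (Set.range (UniversalEnvelopingAlgebra.ι ℂ : A → _)) = ⊤ := by
  let S := Algebra.adjoin ℂ (Set.range (UniversalEnvelopingAlgebra.ι ℂ : A → _))
  let f : A →ₗ⁅ℂ⁆ S :=
    { toFun := fun x => ⟨UniversalEnvelopingAlgebra.ι ℂ x, Algebra.subset_adjoin ⟨x, rfl⟩⟩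
      map_add' := fun x y => Subtype.ext (map_add _ x y)
      map_smul' := fun c x => Subtype.ext (map_smul _ c x)
      map_lie' := fun {x y} => Subtype.ext (LieHom.map_lie _ x y) }
  have h : S.val.comp (UniversalEnvelopingAlgebra.lift ℂ f) = AlgHom.id ℂ _ := by
    ext x
    simp only [LieHom.comp_apply, AlgHom.coe_toLieHom, AlgHom.comp_apply,
      UniversalEnvelopingAlgebra.lift_ι_apply, AlgHom.id_apply]
    rfl
  rw [eq_top_iff]
  rintro u -
  have := DFunLike.congr_fun h u
  rw [AlgHom.comp_apply, AlgHom.id_apply] at this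
  rw [← this]
  exact (UniversalEnvelopingAlgebra.lift ℂ f u).2

end Universal

namespace Ind

variable {A : Type*} [LieRing A] [LieAlgebra ℂ A] (B : LieSubalgebra ℂ A)
  (M : Type*) [AddCommGroup M] [Module ℂ M] [LieRingModule B M]

/-- The quotient map `U(A) ⊗ M → Ind M`. -/
def mk : UniversalEnvelopingAlgebra ℂ A ⊗[ℂ] M →ₗ[UniversalEnvelopingAlgebra ℂ A] Ind B M :=
  (indRel B M).mkQ

/-- The map `v ↦ 1 ⊗ v` from `M` to the induced module. -/
def of : M →ₗ[ℂ] Ind B M :=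
  (mk B M).restrictScalars ℂ ∘ₗ TensorProduct.mk ℂ (UniversalEnvelopingAlgebra ℂ A) M 1

variable {B M}

lemma mk_tmul (u : UniversalEnvelopingAlgebra ℂ A) (v : M) : mk B M (u ⊗ₜ v) = u • of B M v := by
  change _ = u • mk B M (1 ⊗ₜ v)
  rw [← map_smul, TensorProduct.smul_tmul', smul_eq_mul, mul_one]

lemma ι_smul_of (y : B) (v : M) :
    UniversalEnvelopingAlgebra.ι ℂ (y : A) • of B M v = of B M ⁅y, v⁆ := by
  rw [← mk_tmul, ← sub_eq_zero]
  change mk B M _ - mk B M _ = 0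
  rw [← map_sub]
  refine (Submodule.Quotient.mk_eq_zero _).mpr (Submodule.subset_span ⟨1, y, v, ?_⟩)
  rw [one_mul]
  rfl

lemma eq_top_of_of_mem {T : Submodule ℂ (Ind B M)} (hof : ∀ v, of B M v ∈ T)
    (hT : ∀ (x : A), ∀ z ∈ T, UniversalEnvelopingAlgebra.ι ℂ x • z ∈ T) : T = ⊤ := by
  have hU (u : UniversalEnvelopingAlgebra ℂ A) : ∀ z ∈ T, u • z ∈ T := by
    have hu : u ∈ Algebra.adjoin ℂ (Set.range (UniversalEnvelopingAlgebra.ι ℂ : A → _)) := by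
      rw [adjoin_range_ι_eq_top]; trivial
    induction hu using Algebra.adjoin_induction with
    | mem u hu => obtain ⟨x, rfl⟩ := hu; exact hT x
    | algebraMap c => intro z hz; rw [algebraMap_smul]; exact T.smul_mem c hz
    | add p q _ _ hp hq => intro z hz; rw [add_smul]; exact T.add_mem (hp z hz) (hq z hz)
    | mul p q _ _ hp hq => intro z hz; rw [mul_smul]; exact hp _ (hq z hz)
  rw [eq_top_iff]
  rintro z -
  obtain ⟨t, rfl⟩ := Submodule.mkQ_surjective (indRel B M) z
  change mk B M t ∈ T
  induction t using TensorProduct.induction_on with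
  | zero => rw [map_zero]; exact T.zero_mem
  | add x y hx hy => rw [map_add]; exact T.add_mem hx hy
  | tmul u v => rw [mk_tmul]; exact hU u _ (hof v)

/-- By the universal property, a `B`-equivariant map from `M` to an `A`-module factors through
`Ind M`; if it is injective, so is `M → Ind M`. -/
theorem of_injective_of_equivariant {P : Type*} [AddCommGroup P] [Module ℂ P]
    (ρ : A →ₗ⁅ℂ⁆ Module.End ℂ P) (c : M →ₗ[ℂ] P) (hc : Function.Injective c)
    (hρ : ∀ (y : B) (v : M), ρ y (c v) = c ⁅y, v⁆) : Function.Injective (of B M) := by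
  let R := UniversalEnvelopingAlgebra.lift ℂ ρ
  let Ψ : UniversalEnvelopingAlgebra ℂ A ⊗[ℂ] M →ₗ[ℂ] P :=
    TensorProduct.lift ((LinearMap.lcomp ℂ P c) ∘ₗ R.toLinearMap)
  have hΨ (u : UniversalEnvelopingAlgebra ℂ A) (v : M) : Ψ (u ⊗ₜ v) = R u (c v) := rfl
  have hsmul (u : UniversalEnvelopingAlgebra ℂ A) (z) : Ψ (u • z) = R u (Ψ z) := by
    induction z using TensorProduct.induction_on with
    | zero => simp
    | add x y hx hy => simp only [smul_add, map_add, hx, hy]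
    | tmul u' v =>
      rw [TensorProduct.smul_tmul', hΨ, hΨ, smul_eq_mul, map_mul, Module.End.mul_apply]
  have hrel : ∀ z ∈ indRel B M, Ψ z = 0 := fun z hz => by
    induction hz using Submodule.span_induction with
    | mem z hz =>
      obtain ⟨u, y, v, rfl⟩ := hz
      rw [map_sub, hΨ, hΨ, map_mul, Module.End.mul_apply, ← hρ, sub_eq_zero]
      exact congr_arg (fun f : Module.End ℂ P => R u (f (c v)))
        (UniversalEnvelopingAlgebra.lift_ι_apply ℂ ρ (y : A))
    | zero => exact map_zero _
    | add x y _ _ hx hy => rw [map_add, hx, hy, add_zero]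
    | smul u z _ hz => rw [hsmul, hz, map_zero]
  rw [injective_iff_map_eq_zero]
  intro v hv
  have h := hrel _ ((Submodule.Quotient.mk_eq_zero _).mp (show mk B M (1 ⊗ₜ v) = 0 from hv))
  rw [hΨ, map_one, Module.End.one_apply] at h
  exact hc (h.trans (map_zero c).symm)

end Ind

/-! ### The module of functions `ℤ → M` and injectivity of `M → Ind M` -/

namespace Affine

variable {g : Type*} [LieRing g] [LieAlgebra ℂ g]

variable (g) in
/-- The central element `K`. -/
def centralElt : derived g := ⟨⟨0, 1, 0⟩, rfl⟩

variable (g) in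
/-- The degree derivation `d`. -/
def degreeElt : Affine g := ⟨0, 0, 1⟩

variable (g) in
/-- `ofLoop` as a linear map. -/
@[simps]
def ofLoopLinear : Loop g →ₗ[ℂ] derived g where
  toFun := ofLoop
  map_add' a b := by apply Subtype.ext; ext1 <;> simp [ofLoop]
  map_smul' r a := by apply Subtype.ext; ext1 <;> simp [ofLoop]

lemma ofLoop_lie (a b : Loop g) :
    ⁅ofLoop a, ofLoop b⁆ = ofLoop ⁅a, b⁆ + loopCocycle g a b • centralElt g := by
  apply Subtype.ext
  ext1 <;> simp [ofLoop, centralElt]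

lemma centralElt_lie (y : derived g) : ⁅centralElt g, y⁆ = 0 := by
  have hy : y.1.degree = 0 := y.2
  apply Subtype.ext
  ext1 <;> simp [centralElt, hy]

lemma derived_eq (y : derived g) : y = ofLoop y.1.loop + y.1.central • centralElt g := by
  have hy : y.1.degree = 0 := y.2
  apply Subtype.ext
  ext1 <;> simp [ofLoop, centralElt, hy]

lemma affine_eq (x : Affine g) :
    x = (ofLoop x.loop : derived g) + x.central • (centralElt g : Affine g) +
      x.degree • degreeElt g := by
  ext1 <;> simp [ofLoop, centralElt, degreeElt]

lemma degreeElt_lie_ofLoop (a : Loop g) :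
    ⁅degreeElt g, (ofLoop a : Affine g)⁆ = (ofLoop (loopDegree g a) : Affine g) := by
  ext1 <;> simp [ofLoop, degreeElt]

lemma degreeElt_lie_centralElt : ⁅degreeElt g, (centralElt g : Affine g)⁆ = 0 := by
  ext1 <;> simp [centralElt, degreeElt]

lemma lie_add_smul_add_smul {R : Type*} [Ring R] [Algebra ℂ R] (a b c d : R) {r s r' s' : ℂ}
    (hca : ⁅c, a⁆ = 0) (hcb : ⁅c, b⁆ = 0) (hcd : ⁅c, d⁆ = 0) :
    ⁅a + r • c + s • d, b + r' • c + s' • d⁆ = ⁅a, b⁆ + s • ⁅d, b⁆ - s' • ⁅d, a⁆ := by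
  simp only [LieRing.of_associative_ring_bracket, sub_eq_zero] at *
  simp only [mul_add, add_mul, smul_mul_assoc, mul_smul_comm, hca, hcb, hcd]
  module

section Twist

variable (M : Type*) [AddCommGroup M] [Module ℂ M] [LieRingModule (derived g) M]
  [LieModule ℂ (derived g) M]

/-- The operator of `x ⊗ t ^ n` on functions `F : ℤ → M`, namely
`k ↦ (x ⊗ t ^ n) F (k - n)`. -/
def monomialTwist (n : ℤ) : g →ₗ[ℂ] Module.End ℂ (ℤ → M) where
  toFun x := (LieModule.toEnd ℂ (derived g) M (ofLoop (Loop.monomial n x))).compLeft ℤ ∘ₗ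
    LinearMap.funLeft ℂ M (· - n)
  map_add' x y := by
    have : Loop.monomial n (x + y) = Loop.monomial n x + Loop.monomial n y :=
      TensorProduct.tmul_add _ _ _
    rw [this, ← ofLoopLinear_apply, map_add, map_add]
    rfl
  map_smul' r x := by
    rw [← Loop.smul_monomial, ← ofLoopLinear_apply, map_smul, map_smul]
    rfl

/-- The operators of the loop algebra on functions `ℤ → M`: the linear extension of
`monomialTwist`. They only represent the loop algebra up to the cocycle, see `loopTwist_lie`. -/
def loopTwist : Loop g →ₗ[ℂ] Module.End ℂ (ℤ → M) :=
  Finsupp.lsum ℂ (monomialTwist M) ∘ₗ (LieAlgebra.LoopAlgebra.toFinsupp ℂ ℤ g).toLinearMap ∘ₗ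
    (Loop.equiv g).toLinearMap

lemma loopTwist_monomial (n : ℤ) (x : g) (F : ℤ → M) (k : ℤ) :
    loopTwist M (Loop.monomial n x) F k = ⁅ofLoop (Loop.monomial n x), F (k - n)⁆ := by
  have h : LieAlgebra.LoopAlgebra.toFinsupp ℂ ℤ g (Loop.equiv g (Loop.monomial n x))
      = Finsupp.single n x := LieAlgebra.LoopAlgebra.toFinsupp_single_tmul ℂ ℤ g n x
  have h' : loopTwist M (Loop.monomial n x) = monomialTwist M n x := by
    simp only [loopTwist, LinearMap.comp_apply, LinearEquiv.coe_coe, h, Finsupp.lsum_apply]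
    exact Finsupp.sum_single_index (map_zero _)
  rw [h']
  rfl

variable (g) in
/-- The operator of `K` on functions `ℤ → M`, acting on each value. -/
def centralTwist : Module.End ℂ (ℤ → M) :=
  (LieModule.toEnd ℂ (derived g) M (centralElt g)).compLeft ℤ

lemma centralTwist_apply (F : ℤ → M) (k : ℤ) : centralTwist g M F k = ⁅centralElt g, F k⁆ := rfl

/-- The operator of `d` on functions `ℤ → M`, namely `F ↦ (k ↦ k F k)`. -/
def degreeTwist : Module.End ℂ (ℤ → M) where
  toFun F k := (k : ℂ) • F k
  map_add' F G := by ext k; simp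
  map_smul' r F := by funext k; exact smul_comm _ _ _

lemma loopTwist_lie (a b : Loop g) :
    loopTwist M ⁅a, b⁆ + loopCocycle g a b • centralTwist g M = ⁅loopTwist M a, loopTwist M b⁆ := by
  induction a using Loop.induction with
  | zero => simp
  | add a a' ha ha' =>
    simp only [add_lie, map_add, LinearMap.add_apply, add_smul, ← ha, ← ha']; abel
  | monomial m x =>
    induction b using Loop.induction with
    | zero => simp
    | add b b' hb hb' => simp only [lie_add, map_add, add_smul, ← hb, ← hb']; abel
    | monomial n y =>
      ext1 F
      funext k
      simp only [LieRing.of_associative_ring_bracket, LinearMap.sub_apply, Pi.sub_apply,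
        Module.End.mul_apply, loopTwist_monomial, LinearMap.add_apply, LinearMap.smul_apply,
        Pi.add_apply, Pi.smul_apply, centralTwist_apply, Loop.monomial_lie]
      rw [show k - n - m = k - (m + n) by ring, show k - m - n = k - (m + n) by ring, ← lie_lie,
        ofLoop_lie, Loop.monomial_lie, add_lie, smul_lie]
      by_cases h : m + n = 0
      · rw [h, sub_zero]
      · simp [loopCocycle_monomial, h]

lemma degreeTwist_lie_loopTwist (a : Loop g) :
    ⁅degreeTwist M, loopTwist M a⁆ = loopTwist M (loopDegree g a) := by
  induction a using Loop.induction with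
  | zero => simp
  | add a a' ha ha' => simp only [lie_add, map_add, ha, ha']
  | monomial n x =>
    ext1 F
    funext k
    simp only [LieRing.of_associative_ring_bracket, LinearMap.sub_apply, Pi.sub_apply,
      Module.End.mul_apply, loopTwist_monomial, loopDegree_monomial, map_smul,
      LinearMap.smul_apply, Pi.smul_apply]
    simp only [degreeTwist, LinearMap.coe_mk, AddHom.coe_mk, loopTwist_monomial, lie_smul,
      ← sub_smul]
    push_cast
    congr 1
    ring

lemma centralTwist_lie_loopTwist (a : Loop g) : ⁅centralTwist g M, loopTwist M a⁆ = 0 := by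
  induction a using Loop.induction with
  | zero => simp
  | add a a' ha ha' => simp only [lie_add, map_add, ha, ha', add_zero]
  | monomial n x =>
    ext1 F
    funext k
    simp only [LieRing.of_associative_ring_bracket, LinearMap.sub_apply, Pi.sub_apply,
      Module.End.mul_apply, loopTwist_monomial, centralTwist_apply, ← lie_lie, centralElt_lie,
      zero_lie, LinearMap.zero_apply, Pi.zero_apply]

lemma centralTwist_lie_degreeTwist : ⁅centralTwist g M, degreeTwist M⁆ = 0 := by
  ext1 F
  funext k
  simp [LieRing.of_associative_ring_bracket, centralTwist_apply, degreeTwist]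

variable (g) in
/-- The affine algebra acts on functions `ℤ → M`, for a module `M` over its subalgebra
`(g ⊗ ℂ[t, t⁻¹]) ⊕ ℂ K`. A function stands for the formal sum of the `F k ⊗ s ^ k`, where
`x ⊗ t ^ n` multiplies by `s ^ n` and `d` is `s d/ds`. -/
def twist : Affine g →ₗ⁅ℂ⁆ Module.End ℂ (ℤ → M) where
  toFun x := loopTwist M x.loop + x.central • centralTwist g M + x.degree • degreeTwist M
  map_add' x y := by simp only [loop_add, central_add, degree_add, map_add, add_smul]; abel
  map_smul' r x := by
    simp only [loop_smul, central_smul, degree_smul, map_smul, mul_smul, smul_add,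
      RingHom.id_apply]
  map_lie' {x y} := by
    change loopTwist M ⁅x, y⁆.loop + ⁅x, y⁆.central • centralTwist g M +
      ⁅x, y⁆.degree • degreeTwist M =
        ⁅loopTwist M x.loop + x.central • centralTwist g M + x.degree • degreeTwist M,
          loopTwist M y.loop + y.central • centralTwist g M + y.degree • degreeTwist M⁆
    rw [lie_add_smul_add_smul _ _ _ _ (centralTwist_lie_loopTwist M _)
      (centralTwist_lie_loopTwist M _) (centralTwist_lie_degreeTwist M), degreeTwist_lie_loopTwist,
      degreeTwist_lie_loopTwist, ← loopTwist_lie]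
    simp only [loop_lie, central_lie, degree_lie, map_add, map_sub, map_smul]
    module

/-- Constant functions embed `M` into the module of functions `ℤ → M`, equivariantly for
`(g ⊗ ℂ[t, t⁻¹]) ⊕ ℂ K`. -/
theorem of_injective : Function.Injective (Ind.of (derived g) M) := by
  refine Ind.of_injective_of_equivariant (twist g M)
    (LinearMap.pi fun _ : ℤ => LinearMap.id) (fun v w h => congr_fun h 0) fun y v => ?_
  have hl (a : Loop g) : loopTwist M a (fun _ => v) = fun _ => ⁅ofLoop a, v⁆ := by
    induction a using Loop.induction with
    | zero => funext k; simp [← ofLoopLinear_apply]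
    | add a a' ha ha' =>
      funext k; simp [ha, ha', ← ofLoopLinear_apply, add_lie]
    | monomial n x => funext k; rw [loopTwist_monomial]
  have hy : y.1.degree = 0 := y.2
  have h1 : twist g M y (fun _ => v) = loopTwist M y.1.loop (fun _ => v) +
      y.1.central • centralTwist g M (fun _ => v) + y.1.degree • degreeTwist M (fun _ => v) := rfl
  refine h1.trans ?_
  rw [hl, hy, zero_smul, add_zero]
  funext k
  change _ = ⁅y, v⁆
  conv_rhs => rw [derived_eq y]
  simp [centralTwist_apply]

end Twist

end Affine

/-! ### Expansion in powers of `d` -/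

namespace Affine

variable {g : Type*} [LieRing g] [LieAlgebra ℂ g]
  {M : Type*} [AddCommGroup M] [Module ℂ M] [LieRingModule (derived g) M]

variable (g) in
/-- The element `d` of the enveloping algebra. -/
def degreeU : UniversalEnvelopingAlgebra ℂ (Affine g) :=
  UniversalEnvelopingAlgebra.ι ℂ (degreeElt g)

lemma ι_monomial_mul_degreeU (n : ℤ) (x : g) :
    UniversalEnvelopingAlgebra.ι ℂ (ofLoop (Loop.monomial n x) : Affine g) * degreeU g =
      (algebraMap ℂ _ (-(n : ℂ)) + degreeU g) *
        UniversalEnvelopingAlgebra.ι ℂ (ofLoop (Loop.monomial n x) : Affine g) := by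
  have h : (⁅degreeElt g, (ofLoop (Loop.monomial n x) : Affine g)⁆ : Affine g) =
      (n : ℂ) • (ofLoop (Loop.monomial n x) : Affine g) := by
    rw [degreeElt_lie_ofLoop, loopDegree_monomial, ← ofLoopLinear_apply, map_smul]
    rfl
  have h' := congr_arg (UniversalEnvelopingAlgebra.ι ℂ) h
  rw [LieHom.map_lie, LieRing.of_associative_ring_bracket, map_smul, sub_eq_iff_eq_add] at h'
  rw [add_mul, degreeU, h', map_neg, neg_mul, ← Algebra.smul_def]
  abel

/-- As `(x ⊗ t ^ n) d = (d - n) (x ⊗ t ^ n)`, the element `x ⊗ t ^ n` maps `d ^ j ⊗ u` to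
`(d - n) ^ j ⊗ (x ⊗ t ^ n) u`, written here by powers of `n`. The sum may extend beyond `l = j`, where
the binomial coefficients vanish and `j - l` is truncated. -/
lemma ι_monomial_smul_degreeU_pow_smul (n : ℤ) (x : g) {j N : ℕ} (hj : j ≤ N) (u : M) :
    UniversalEnvelopingAlgebra.ι ℂ (ofLoop (Loop.monomial n x) : Affine g) •
        degreeU g ^ j • Ind.of (derived g) M u =
      ∑ l ∈ Finset.range (N + 1), (n : ℂ) ^ l • ((-1) ^ l * (j.choose l : ℂ)) •
        degreeU g ^ (j - l) • Ind.of (derived g) M ⁅ofLoop (Loop.monomial n x), u⁆ := by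
  have hc : Commute (algebraMap ℂ (UniversalEnvelopingAlgebra ℂ (Affine g)) (-(n : ℂ)))
    (degreeU g) := Algebra.commutes _ _
  have h : SemiconjBy (UniversalEnvelopingAlgebra.ι ℂ (ofLoop (Loop.monomial n x) : Affine g))
    (degreeU g) _ := ι_monomial_mul_degreeU n x
  rw [← mul_smul, (h.pow_right j).eq, mul_smul, Ind.ι_smul_of, hc.add_pow, Finset.sum_smul]
  rw [← Finset.sum_subset (Finset.range_mono (Nat.succ_le_succ hj))]
  · refine Finset.sum_congr rfl fun l _ => ?_
    rw [← map_pow, mul_assoc, mul_smul, algebraMap_smul, neg_pow, ← Nat.cast_commute,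
      mul_smul (j.choose l : UniversalEnvelopingAlgebra ℂ (Affine g)), Nat.cast_smul_eq_nsmul,
      ← Nat.cast_smul_eq_nsmul ℂ, smul_smul, smul_smul]
    congr 1
    ring
  · intro l _ hl
    rw [Nat.choose_eq_zero_of_lt (by simpa using hl)]
    simp

/-- The map from finitely supported sequences in `M` to the induced module,
`(u_j) ↦ ∑ j, d ^ j ⊗ u_j`. -/
def degreeExpansion : (ℕ →₀ M) →ₗ[ℂ] Ind (derived g) M :=
  Finsupp.lsum ℂ fun j =>
    (Module.toModuleEnd ℂ (S := UniversalEnvelopingAlgebra ℂ (Affine g)) (Ind (derived g) M)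
      (degreeU g ^ j)) ∘ₗ Ind.of (derived g) M

lemma degreeExpansion_single (j : ℕ) (u : M) :
    degreeExpansion (g := g) (Finsupp.single j u) = degreeU g ^ j • Ind.of (derived g) M u := by
  simp only [degreeExpansion, Finsupp.lsum_apply]
  exact Finsupp.sum_single_index (map_zero _)

theorem degreeExpansion_surjective [LieModule ℂ (derived g) M] :
    Function.Surjective (degreeExpansion (g := g) (M := M)) := by
  rw [← LinearMap.range_eq_top]
  have hmem (j : ℕ) (u : M) :
      degreeU g ^ j • Ind.of (derived g) M u ∈ LinearMap.range (degreeExpansion (g := g) (M := M)) :=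
    ⟨_, degreeExpansion_single j u⟩
  refine Ind.eq_top_of_of_mem (fun v => by simpa using hmem 0 v) fun x z hz => ?_
  obtain ⟨f, rfl⟩ := hz
  induction f using Finsupp.induction_linear with
  | zero => simp
  | add f f' hf hf' => rw [map_add, smul_add]; exact Submodule.add_mem _ hf hf'
  | single j u =>
    rw [degreeExpansion_single, affine_eq x, map_add, map_add, add_smul, add_smul, map_smul,
      map_smul, smul_assoc, smul_assoc]
    refine Submodule.add_mem _ (Submodule.add_mem _ ?_ (Submodule.smul_mem _ _ ?_))
      (Submodule.smul_mem _ _ ?_)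
    · generalize x.loop = b
      induction b using Loop.induction with
      | zero => rw [← ofLoopLinear_apply, map_zero]; simp
      | add b b' hb hb' =>
        rw [← ofLoopLinear_apply, map_add, AddMemClass.coe_add, map_add, add_smul]
        exact Submodule.add_mem _ hb hb'
      | monomial n y =>
        rw [ι_monomial_smul_degreeU_pow_smul n y le_rfl]
        exact Submodule.sum_mem _ fun l _ =>
          Submodule.smul_mem _ _ (Submodule.smul_mem _ _ (hmem _ _))
    · have h : Commute (UniversalEnvelopingAlgebra.ι ℂ (centralElt g : Affine g)) (degreeU g) := by
        have h' := congr_arg (UniversalEnvelopingAlgebra.ι ℂ) (degreeElt_lie_centralElt (g := g))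
        rw [LieHom.map_lie, LieRing.of_associative_ring_bracket, map_zero, sub_eq_zero] at h'
        exact h'.symm
      rw [← mul_smul, (h.pow_right j).eq, mul_smul, Ind.ι_smul_of]
      exact hmem _ _
    · rw [← mul_smul]
      change (degreeU g * degreeU g ^ j) • _ ∈ _
      rw [← pow_succ']
      exact hmem _ _

end Affine

/-! ### Irreducibility of the induced module -/

section Main

variable {g : Type*} [LieRing g] [LieAlgebra ℂ g]
  {m : ℕ} (a : Fin m → ℂˣ)
  {V : Fin m → Type*} [∀ i, AddCommGroup (V i)] [∀ i, Module ℂ (V i)]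
  [∀ i, LieRingModule g (V i)] [∀ i, LieModule ℂ g (V i)]
  {L : Type*} [AddCommGroup L] [Module ℂ L]
  [LieRingModule (Affine.derived g) L] [LieModule ℂ (Affine.derived g) L]

variable (V) in
/-- The operator `AffineLie.slot V i f`, on the type synonym `Eval V a`. -/
def Eval.slot (i : Fin m) : Module.End ℂ (V i) →ₗ[ℂ] Module.End ℂ (Eval V a) :=
  AffineLie.slot V i

variable (V L) in
/-- The operator `AffineLie.slotEnd V L i f`, on the type synonym `Eval V a`. -/
def Eval.slotEnd (i : Fin m) : Module.End ℂ (V i) →ₗ[ℂ] Module.End ℂ (Eval V a ⊗[ℂ] L) :=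
  LinearMap.rTensorHom L ∘ₗ Eval.slot a V i

lemma lie_eval_tensor (y : Affine.derived g) (z : Eval V a ⊗[ℂ] L) :
    ⁅y, z⁆ = ∑ i, Eval.slotEnd a V L i (LieModule.toEnd ℂ g (V i) (evalLoop g (a i) y.1.loop)) z +
      (LieModule.toEnd ℂ (Affine.derived g) L y).lTensor (Eval V a) z := by
  induction z using TensorProduct.induction_on with
  | zero => simp
  | add z z' hz hz' =>
    rw [lie_add, hz, hz']
    simp only [map_add, Finset.sum_add_distrib]
    abel
  | tmul u l =>
    rw [TensorProduct.LieModule.lie_tmul_right]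
    congr 1
    have h : ⁅y, u⁆ =
        ∑ i, Eval.slot a V i (LieModule.toEnd ℂ g (V i) (evalLoop g (a i) y.1.loop)) u := by
      rw [← LinearMap.sum_apply]
      change (∑ i, AffineLie.slot V i ∘ₗ (LieModule.toEnd ℂ g (V i)).toLinearMap ∘ₗ
        (evalLoop g (a i)).toLinearMap) _ u = _
      rw [LinearMap.sum_apply]
      rfl
    rw [h, TensorProduct.sum_tmul]
    rfl

/-- For large `k` the element `x ⊗ t ^ k` acts on the factor `L` by zero on a given tensor. -/
lemma exists_forall_lie_monomial_eq (hL : ∀ v : L, ∃ k₀ : ℕ, ∀ k : ℕ, k₀ ≤ k → ∀ x : g,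
      ⁅Affine.ofLoop (Loop.monomial (k : ℤ) x), v⁆ = 0) (z : Eval V a ⊗[ℂ] L) :
    ∃ k₀ : ℕ, ∀ k : ℕ, k₀ ≤ k → ∀ x : g, ⁅Affine.ofLoop (Loop.monomial (k : ℤ) x), z⁆ =
      ∑ i, (a i : ℂ) ^ k • Eval.slotEnd a V L i (LieModule.toEnd ℂ g (V i) x) z := by
  suffices h : ∃ k₀ : ℕ, ∀ k : ℕ, k₀ ≤ k → ∀ x : g, (LieModule.toEnd ℂ (Affine.derived g) L
      (Affine.ofLoop (Loop.monomial (k : ℤ) x))).lTensor (Eval V a) z = 0 by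
    obtain ⟨k₀, hk₀⟩ := h
    refine ⟨k₀, fun k hk x => ?_⟩
    rw [lie_eval_tensor, hk₀ k hk x, add_zero]
    refine Finset.sum_congr rfl fun i _ => ?_
    have : evalLoop g (a i) (Loop.monomial (k : ℤ) x) = ((a i : ℂ) ^ k) • x := by
      refine (evalLoopLinear_monomial (a i) k x).trans ?_
      simp
    change Eval.slotEnd a V L i (LieModule.toEnd ℂ g (V i) (evalLoop g (a i) (Loop.monomial (k : ℤ) x))) z = _
    rw [this, map_smul, map_smul, LinearMap.smul_apply]
  induction z using TensorProduct.induction_on with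
  | zero => exact ⟨0, by simp⟩
  | add z z' hz hz' =>
    obtain ⟨k₀, h⟩ := hz
    obtain ⟨k₁, h'⟩ := hz'
    refine ⟨max k₀ k₁, fun k hk x => ?_⟩
    rw [map_add, h k (le_of_max_le_left hk), h' k (le_of_max_le_right hk), add_zero]
  | tmul u l =>
    obtain ⟨k₀, h⟩ := hL l
    refine ⟨k₀, fun k hk x => ?_⟩
    rw [LinearMap.lTensor_tmul, LieModule.toEnd_apply_apply, h k hk x, TensorProduct.tmul_zero]

/-- If a submodule contains `∑ j ≤ N, d ^ j ⊗ u_j`, then it contains `1 ⊗ x_i u_N`, where `x_i` acts on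
the `i`-th factor only. For large `k`, the element `x ⊗ t ^ k` maps the sum to an exponential
polynomial in `k`, whose coefficient at `a_i ^ k k ^ N` is `(-1) ^ N ⊗ x_i u_N`. -/
theorem of_slotEnd_mem (ha : Function.Injective a)
    (hL : ∀ v : L, ∃ k₀ : ℕ, ∀ k : ℕ, k₀ ≤ k → ∀ x : g,
      ⁅Affine.ofLoop (Loop.monomial (k : ℤ) x), v⁆ = 0)
    (W : LieSubmodule ℂ (Affine g) (Ind (Affine.derived g) (Eval V a ⊗[ℂ] L)))
    (N : ℕ) (u : ℕ → Eval V a ⊗[ℂ] L)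
    (hu : ∑ j ∈ Finset.range (N + 1), Affine.degreeU g ^ j • Ind.of (Affine.derived g) _ (u j) ∈ W)
    (i : Fin m) (x : g) :
    Ind.of (Affine.derived g) (Eval V a ⊗[ℂ] L)
      (Eval.slotEnd a V L i (LieModule.toEnd ℂ g (V i) x) (u N)) ∈ W := by
  let q := W.toSubmodule.mkQ
  -- `w i l` is the coefficient at `a i ^ k * k ^ l`.
  let w (i : Fin m) (l : ℕ) : Ind (Affine.derived g) (Eval V a ⊗[ℂ] L) :=
    ∑ j ∈ Finset.range (N + 1), ((-1) ^ l * (j.choose l : ℂ)) • Affine.degreeU g ^ (j - l) •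
      Ind.of (Affine.derived g) _ (Eval.slotEnd a V L i (LieModule.toEnd ℂ g (V i) x) (u j))
  choose k₀ hk₀ using fun j => exists_forall_lie_monomial_eq a hL (u j)
  have key : ∀ k, (Finset.range (N + 1)).sup k₀ ≤ k →
      ∑ i, ∑ l ∈ Finset.range (N + 1), ((a i : ℂ) ^ k * (k : ℂ) ^ l) • q (w i l) = 0 := by
    intro k hk
    have hmem := W.lie_mem (x := (Affine.ofLoop (Loop.monomial (k : ℤ) x) : Affine g)) hu
    rw [Ind.lie_def, Finset.smul_sum] at hmem
    have e : ∑ i, ∑ l ∈ Finset.range (N + 1), ((a i : ℂ) ^ k * (k : ℂ) ^ l) • w i l =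
        ∑ j ∈ Finset.range (N + 1),
          UniversalEnvelopingAlgebra.ι ℂ (Affine.ofLoop (Loop.monomial (k : ℤ) x) : Affine g) •
            Affine.degreeU g ^ j • Ind.of (Affine.derived g) _ (u j) := by
      have e1 : ∀ j ∈ Finset.range (N + 1),
          UniversalEnvelopingAlgebra.ι ℂ (Affine.ofLoop (Loop.monomial (k : ℤ) x) : Affine g) •
            Affine.degreeU g ^ j • Ind.of (Affine.derived g) _ (u j) =
          ∑ i, ∑ l ∈ Finset.range (N + 1), ((a i : ℂ) ^ k * (k : ℂ) ^ l) •
            ((-1) ^ l * (j.choose l : ℂ)) • Affine.degreeU g ^ (j - l) •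
            Ind.of (Affine.derived g) _ (Eval.slotEnd a V L i (LieModule.toEnd ℂ g (V i) x) (u j)) := by
        intro j hj
        rw [Affine.ι_monomial_smul_degreeU_pow_smul _ _ (Nat.lt_succ_iff.mp (Finset.mem_range.mp hj)),
          hk₀ j k ((Finset.le_sup hj).trans hk) x, Finset.sum_comm]
        refine Finset.sum_congr rfl fun l _ => ?_
        simp only [map_sum, Finset.smul_sum, map_smul, Int.cast_natCast]
        refine Finset.sum_congr rfl fun i _ => ?_
        rw [smul_algebra_smul_comm ((a i : ℂ) ^ k) (Affine.degreeU g ^ (j - l))]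
        simp only [smul_smul]
        congr 1
        ring
      rw [Finset.sum_congr rfl e1, Finset.sum_comm (s := Finset.range (N + 1))]
      refine Finset.sum_congr rfl fun i _ => ?_
      rw [Finset.sum_comm]
      exact Finset.sum_congr rfl fun l _ => Finset.smul_sum
    have e2 := congr_arg q e
    simp only [map_sum, map_smul] at e2
    rw [e2, ← map_sum]
    exact (Submodule.Quotient.mk_eq_zero _).mpr hmem
  have h0 := coeff_eq_zero_of_expPoly_eq_zero a ha (N + 1) _ (fun i l => q (w i l)) key i N
    (Nat.lt_succ_self N)
  have hw : w i N = (-1 : ℂ) ^ N • Ind.of (Affine.derived g) (Eval V a ⊗[ℂ] L)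
      (Eval.slotEnd a V L i (LieModule.toEnd ℂ g (V i) x) (u N)) := by
    simp only [w]
    rw [Finset.sum_range_succ, Finset.sum_eq_zero, zero_add]
    · simp
    · intro j hj
      rw [Nat.choose_eq_zero_of_lt (Finset.mem_range.mp hj)]
      simp
  have hmem : w i N ∈ W := (Submodule.Quotient.mk_eq_zero _).mp h0
  rw [hw] at hmem
  have := W.smul_mem ((-1 : ℂ) ^ N) hmem
  rwa [smul_smul, ← mul_pow, neg_one_mul, neg_neg, one_pow, one_smul] at this

/-- The irreducibility theorem, where the condition that some highest weight is nonzero is replaced by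
the existence of an eigenvector of nonzero eigenvalue in one of the factors. -/
theorem isIrreducible_ind_eval_tensor [FiniteDimensional ℂ g] (ha : Function.Injective a)
    (hVirr : ∀ i, LieModule.IsIrreducible ℂ g (V i))
    (hLirr : LieModule.IsIrreducible ℂ (Affine.derived g) L)
    (hL : ∀ v : L, ∃ k₀ : ℕ, ∀ k : ℕ, k₀ ≤ k → ∀ x : g,
      ⁅Affine.ofLoop (Loop.monomial (k : ℤ) x), v⁆ = 0)
    {i₀ : Fin m} {v₀ : V i₀} {h₀ : g} {c : ℂ} (hc : c ≠ 0) (hv₀ : v₀ ≠ 0)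
    (hh₀ : ⁅h₀, v₀⁆ = c • v₀) :
    LieModule.IsIrreducible ℂ (Affine g) (Ind (Affine.derived g) (Eval V a ⊗[ℂ] L)) := by
  have hntL : Nontrivial L :=
    (LieSubmodule.nontrivial_iff ℂ (Affine.derived g) L).mp hLirr.toNontrivial
  have hntM : Nontrivial (Eval V a ⊗[ℂ] L) := by
    have hntV (i) : Nontrivial (V i) :=
      (LieSubmodule.nontrivial_iff ℂ g (V i)).mp (hVirr i).toNontrivial
    choose v hv using fun i => exists_ne (0 : V i)
    obtain ⟨l, hl⟩ := exists_ne (0 : L)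
    exact ⟨⟨_, 0, tprod_tmul_ne_zero hv hl⟩⟩
  have hntInd : Nontrivial (Ind (Affine.derived g) (Eval V a ⊗[ℂ] L)) :=
    (Affine.of_injective (Eval V a ⊗[ℂ] L)).nontrivial
  refine LieModule.IsIrreducible.mk fun W hW => ?_
  let W₀ : Submodule ℂ (Eval V a ⊗[ℂ] L) :=
    W.toSubmodule.comap (Ind.of (Affine.derived g) (Eval V a ⊗[ℂ] L))
  have hslot (i : Fin m) (x : g) :
      ∀ u ∈ W₀, Eval.slotEnd a V L i (LieModule.toEnd ℂ g (V i) x) u ∈ W₀ := fun u hu =>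
    of_slotEnd_mem a ha hL W 0 (fun _ => u) (by simpa using (show Ind.of _ _ u ∈ W from hu)) i x
  have hright (y : Affine.derived g) :
      ∀ u ∈ W₀, (LieModule.toEnd ℂ (Affine.derived g) L y).lTensor (Eval V a) u ∈ W₀ := by
    intro u hu
    rw [← sub_eq_of_eq_add' (lie_eval_tensor a y u)]
    refine W₀.sub_mem ?_ (W₀.sum_mem fun i _ => hslot i _ u hu)
    have := W.lie_mem (x := (y : Affine g)) hu
    change Ind.of _ _ _ ∈ W
    rw [← Ind.ι_smul_of]
    exact this
  have hne : W₀ ≠ ⊥ := by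
    obtain ⟨z, hz, hz0⟩ := W.toSubmodule.exists_mem_ne_zero_of_ne_bot (by simpa using hW)
    obtain ⟨f, rfl⟩ := Affine.degreeExpansion_surjective z
    have hf : f.support.Nonempty := by
      rw [Finsupp.support_nonempty_iff]
      rintro rfl
      exact hz0 (map_zero _)
    -- The leading coefficient `f N` is nonzero in `E ⊗ L`, whatever the relations in `Ind`.
    let N := f.support.max' hf
    have hN : f N ≠ 0 := Finsupp.mem_support_iff.mp (f.support.max'_mem hf)
    have hsum : Affine.degreeExpansion (g := g) f = ∑ j ∈ Finset.range (N + 1),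
        Affine.degreeU g ^ j • Ind.of (Affine.derived g) _ (f j) := by
      conv_lhs => rw [← f.sum_single]
      rw [Finsupp.sum_of_support_subset f (s := Finset.range (N + 1)) (fun j hj => ?_) _ (by simp),
        map_sum]
      · exact Finset.sum_congr rfl fun j _ => Affine.degreeExpansion_single j (f j)
      · exact Finset.mem_range.mpr (Nat.lt_succ_of_le (f.support.le_max' j hj))
    rw [hsum] at hz
    obtain ⟨x, hx⟩ := exists_slotEnd_ne_zero hVirr hLirr i₀ hc hv₀ hh₀ hN
    exact fun h => hx ((Submodule.eq_bot_iff _).mp h _ (of_slotEnd_mem a ha hL W N f hz i₀ x))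
  have htop : W₀ = ⊤ :=
    (eq_bot_or_eq_top_of_slotEnd_mem hVirr hLirr W₀ hslot hright).resolve_left hne
  have hW' : W.toSubmodule = ⊤ := Ind.eq_top_of_of_mem
    (fun u => show u ∈ W₀ by rw [htop]; trivial) fun x z hz => W.lie_mem hz
  simpa using hW'

end Main

end AffineLie

end

theorem theorem3p4
    {g : Type*} [LieRing g] [LieAlgebra ℂ g] [FiniteDimensional ℂ g] [LieAlgebra.IsSimple ℂ g]
    (H : LieSubalgebra ℂ g) [H.IsCartanSubalgebra]
    (b : (LieAlgebra.IsKilling.rootSystem H).Base)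
    {m : ℕ} (a : Fin m → ℂˣ) (ha : Function.Injective a)
    (wt : Fin m → Module.Dual ℂ H) (hwt : wt ≠ 0)
    (V : Fin m → Type*) [∀ i, AddCommGroup (V i)] [∀ i, Module ℂ (V i)]
    [∀ i, LieRingModule g (V i)] [∀ i, LieModule ℂ g (V i)]
    (hVirr : ∀ i, LieModule.IsIrreducible ℂ g (V i))
    (hVwt : ∀ i, AffineLie.IsHighestWeightModule b (wt i) (V i))
    (L : Type*) [AddCommGroup L] [Module ℂ L]
    [LieRingModule (AffineLie.Affine.derived g) L] [LieModule ℂ (AffineLie.Affine.derived g) L]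
    (hLirr : LieModule.IsIrreducible ℂ (AffineLie.Affine.derived g) L)
    (hL : ∀ v : L, ∃ k₀ : ℕ, ∀ k : ℕ, k₀ ≤ k → ∀ (p : Polynomial ℂ) (x : g),
      ⁅AffineLie.Affine.ofLoop (AffineLie.Loop.tmul
        (LaurentPolynomial.T (k : ℤ) * Polynomial.toLaurent p) x), v⁆ = 0) :
    LieModule.IsIrreducible ℂ (AffineLie.Affine g)
      (AffineLie.Ind (AffineLie.Affine.derived g) (AffineLie.Eval V a ⊗[ℂ] L)) := by
  have hL' : ∀ v : L, ∃ k₀ : ℕ, ∀ k : ℕ, k₀ ≤ k → ∀ x : g,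
      ⁅AffineLie.Affine.ofLoop (AffineLie.Loop.monomial (k : ℤ) x), v⁆ = 0 := fun v => by
    obtain ⟨k₀, h⟩ := hL v
    refine ⟨k₀, fun k hk x => ?_⟩
    have := h k hk 1 x
    rw [map_one, mul_one] at this
    exact this
  obtain ⟨i₀, hi₀⟩ := Function.ne_iff.mp hwt
  obtain ⟨h₀, hh₀⟩ : ∃ h₀, wt i₀ h₀ ≠ 0 := by
    by_contra! h
    exact hi₀ (LinearMap.ext h)
  obtain ⟨v₀, hv₀, -⟩ := hVwt i₀
  exact AffineLie.isIrreducible_ind_eval_tensor a ha hVirr hLirr hL' hh₀ hv₀.ne_zero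
    (hv₀.cartan h₀)
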